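/- Let $S$ be a finite set of $N$ points in the Euclidean plane in general position (no three distinct points of $S$ are collinear), and let $h$ be the number of points of $S$ that lie on the boundary of the convex hull of $S$. A crossing-free straight-edge graph on $S$ is a simple graph with (labeled) vertex set $S$ whose edges, drawn as straight segments between their endpoints, pairwise have no point in common except possibly a shared endpoint. A triangulation of $S$ is a crossing-free straight-edge graph on $S$ that is maximal with respect to inclusion of edge sets. Let $\mathrm{pg}(S)$ be the number of crossing-free straight-edge graphs on $S$ and $\mathrm{tr}(S)$ the number of triangulations of $S$. Then \[ \mathrm{pg}(S)\le \frac{(4\sqrt3)^N}{2^h}\,\mathrm{tr}(S)\quad\text{if } h\le N/2, \qquad \mathrm{pg}(S)\le 8^N\left(\tfrac38\right)^h\mathrm{tr}(S)\quad\text{if } h> N/2 . \] Moreover, if $h\le N/2$ and $N\ge 1$, then $\frac{(4\sqrt3)^N}{2^h}\,\mathrm{tr}(S)<\frac{6.9283^N}{2^h}\,\mathrm{tr}(S)$. -/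

import Mathlib

namespace PlaneGraphs

/-- The Euclidean plane. -/
abbrev Plane : Type := EuclideanSpace ℝ (Fin 2)

/-- General position: no three distinct points of `S` are collinear. -/
def GeneralPosition (S : Finset Plane) : Prop :=
  ∀ a ∈ S, ∀ b ∈ S, ∀ c ∈ S, a ≠ b → a ≠ c → b ≠ c →
    ¬ Collinear ℝ ({a, b, c} : Set Plane)

/-- The number of points of `S` that lie on the boundary of the convex hull of `S`. -/
noncomputable def hullCount (S : Finset Plane) : ℕ :=
  {p : Plane | p ∈ S ∧ p ∈ frontier (convexHull ℝ (S : Set Plane))}.ncard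

/-- A graph on the (labeled) vertex set `S`, drawn with straight edges, is crossing-free if two
different edges have no point in common other than a shared endpoint. -/
def IsCrossingFree {S : Finset Plane} (G : SimpleGraph S) : Prop :=
  ∀ a b c d : S, G.Adj a b → G.Adj c d → s(a, b) ≠ s(c, d) →
    segment ℝ (a : Plane) (b : Plane) ∩ segment ℝ (c : Plane) (d : Plane) ⊆
      ({(a : Plane), (b : Plane)} : Set Plane) ∩ {(c : Plane), (d : Plane)}

/-- A triangulation of `S` is a crossing-free straight-edge graph on `S` that is maximal with
respect to inclusion of the edge sets. -/
def IsTriangulation {S : Finset Plane} (T : SimpleGraph S) : Prop :=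
  Maximal IsCrossingFree T

/-- The number of crossing-free straight-edge graphs on `S`. -/
noncomputable def pg (S : Finset Plane) : ℕ :=
  {G : SimpleGraph S | IsCrossingFree G}.ncard

/-- The number of triangulations of `S`. -/
noncomputable def tr (S : Finset Plane) : ℕ :=
  {T : SimpleGraph S | IsTriangulation T}.ncard

end PlaneGraphs

/-! Charge every crossing-free graph `G` with total weight one, spread evenly over the
triangulations containing it. Then `pg` is the sum over triangulations `T` of the sum over `G ≤ T`
of `1 / supp G`, where `supp G` counts the triangulations containing `G`, and it suffices to bound
the inner sum for each `T`.

Call a subgraph of `T` convex-faced if it keeps all hull edges and no angle of at least `π` opens at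
an interior point. If `Q ≤ T` is convex-faced, every edge of `T` missing from `Q` is the diagonal of
a convex quadrilateral and can be flipped; branching on keeping or flipping one edge at a time
yields at least `2 ^ |T \ Q|` triangulations containing `Q` (`two_pow_le_ncard`). Applied to `G ⊔ P`
with `P ≤ T` a fixed convex-faced graph, this bounds the inner sum by a product over the edges of
`T`, with a factor `2` for edges of `P` and `3/2` for the others (`card_crossingFree_le`).

It remains to find a sparse `P`. In a minimal convex-faced subgraph each non-hull edge is
indispensable at one of its endpoints, its owner, and a point owns at most three edges. Hence `|P| ≤
3N - 2h`. A point owning two or three edges uses up triangles of `T` not used by other points; as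
`T` has at most `2N - h` triangles, also `2|P| ≤ 5N - 2h` (`exists_sparse_convexFaces`). With `|T| ≤
3N - h` the two bounds on `|P|` give the two estimates. -/

namespace PlaneGraphs

/-! ### Orientations, angular order and crossing segments. -/

/-- Twice the signed area of the triangle `a b c`. -/
def orient (a b c : ℝ × ℝ) : ℝ :=
  (b.1 - a.1) * (c.2 - a.2) - (b.2 - a.2) * (c.1 - a.1)

/-- A labelled planar point set in general position with pairwise distinct abscissae. -/
structure PointConfig (V : Type*) where
  pos : V → ℝ × ℝ
  general : ∀ a b c, a ≠ b → a ≠ c → b ≠ c → orient (pos a) (pos b) (pos c) ≠ 0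
  fst_injective : Function.Injective fun v => (pos v).1

namespace PointConfig

variable {V : Type*} (C : PointConfig V)

/-- The orientation of a triple of labels. -/
def o (a b c : V) : ℝ := orient (C.pos a) (C.pos b) (C.pos c)

/-- The abscissa of a labelled point. -/
def x (a : V) : ℝ := (C.pos a).1

/-- The ordinate of a labelled point. -/
def y (a : V) : ℝ := (C.pos a).2

lemma o_def (a b c : V) : C.o a b c =
    (C.x b - C.x a) * (C.y c - C.y a) - (C.y b - C.y a) * (C.x c - C.x a) := rfl

@[simp] lemma o_self_left (a b : V) : C.o a a b = 0 := by simp [o_def]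
@[simp] lemma o_self_right (a b : V) : C.o a b b = 0 := by simp only [o_def]; ring
@[simp] lemma o_self_outer (a b : V) : C.o a b a = 0 := by simp [o_def]

lemma o_rot (a b c : V) : C.o b c a = C.o a b c := by simp only [o_def]; ring
lemma o_swap (a b c : V) : C.o a c b = -C.o a b c := by simp only [o_def]; ring
lemma o_swap_left (a b c : V) : C.o b a c = -C.o a b c := by simp only [o_def]; ring

/-- The three-term Grassmann–Plücker relation for four vectors based at `v`; it transfers sign
information between directions at `v`. -/
lemma plucker (v a b c d : V) :
    C.o v a b * C.o v c d - C.o v a c * C.o v b d + C.o v a d * C.o v b c = 0 := by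
  simp only [o_def]; ring

lemma o_ne_zero {a b c : V} (hab : a ≠ b) (hac : a ≠ c) (hbc : b ≠ c) : C.o a b c ≠ 0 :=
  C.general a b c hab hac hbc

lemma x_ne {a b : V} (h : a ≠ b) : C.x a ≠ C.x b := fun h' => h (C.fst_injective h')

lemma ne_of_o_ne_zero {a b c : V} (h : C.o a b c ≠ 0) : a ≠ b ∧ a ≠ c ∧ b ≠ c := by
  refine ⟨?_, ?_, ?_⟩ <;> rintro rfl <;> simp at h

lemma eq_of_o_nonpos {v a b : V} (ha : v ≠ a) (hb : v ≠ b) (h1 : C.o v a b ≤ 0)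
    (h2 : C.o v b a ≤ 0) : a = b := by
  by_contra h
  have := C.o_ne_zero ha hb h
  rw [C.o_swap] at h2
  exact this (le_antisymm h1 (by linarith))

/-- The reflected configuration. -/
def mirror : PointConfig V where
  pos v := ((C.pos v).1, -(C.pos v).2)
  general a b c h1 h2 h3 := by
    have := C.general a b c h1 h2 h3
    contrapose! this
    simp only [orient] at this ⊢
    linarith
  fst_injective := C.fst_injective

@[simp] lemma mirror_o (a b c : V) : C.mirror.o a b c = -C.o a b c := by
  simp only [o, mirror, orient]; ring

/-- In an open half-plane through `v`, the angular order around `v` is measured by a real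
function. -/
lemma exists_slope (v u : V) : ∃ κ : V → ℝ, ∀ z z', 0 < C.o v u z → 0 < C.o v u z' →
    κ z' ≤ κ z → 0 ≤ C.o v z z' := by
  -- The witness is the cotangent of the angle from `vu` to `vz`, which decreases on `(0, π)`:
  -- larger values come earlier counterclockwise.
  refine ⟨fun z => ((C.x u - C.x v) * (C.x z - C.x v) + (C.y u - C.y v) * (C.y z - C.y v)) /
    C.o v u z, fun z z' h h' h1 => ?_⟩
  rw [div_le_div_iff₀ h' h] at h1
  have huv : 0 < (C.x u - C.x v) ^ 2 := by
    have : v ≠ u := (C.ne_of_o_ne_zero h.ne').1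
    have := sub_ne_zero.2 (C.x_ne this.symm)
    positivity
  have hpos : 0 < (C.x u - C.x v) ^ 2 + (C.y u - C.y v) ^ 2 := by positivity
  have key : ((C.x u - C.x v) ^ 2 + (C.y u - C.y v) ^ 2) * C.o v z z' =
    ((C.x u - C.x v) * (C.x z - C.x v) + (C.y u - C.y v) * (C.y z - C.y v)) * C.o v u z' -
    ((C.x u - C.x v) * (C.x z' - C.x v) + (C.y u - C.y v) * (C.y z' - C.y v)) * C.o v u z := by
    simp only [o_def]; ring
  by_contra hneg
  have := mul_neg_of_pos_of_neg hpos (not_le.1 hneg)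
  linarith

/-- In an open half-plane through `v`, a finite set has a first point in counterclockwise order. -/
lemma exists_first {v u : V} (A : Finset V) (hA : A.Nonempty) (h : ∀ z ∈ A, 0 < C.o v u z) :
    ∃ z ∈ A, ∀ z' ∈ A, 0 ≤ C.o v z z' := by
  obtain ⟨κ, hκ⟩ := C.exists_slope v u
  obtain ⟨z, hz, hmax⟩ := A.exists_max_image κ hA
  exact ⟨z, hz, fun z' hz' => hκ z z' (h z hz) (h z' hz') (hmax z' hz')⟩

lemma exists_last {v u : V} (A : Finset V) (hA : A.Nonempty) (h : ∀ z ∈ A, C.o v u z < 0) :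
    ∃ z ∈ A, ∀ z' ∈ A, C.o v z z' ≤ 0 := by
  obtain ⟨z, hz, h'⟩ := C.mirror.exists_first (v := v) (u := u) A hA (fun z hz => by simpa using h z hz)
  exact ⟨z, hz, fun z' hz' => by simpa using h' z' hz'⟩

/-- The segments `ab` and `cd` cross in a common relative interior point. -/
def Crosses (a b c d : V) : Prop := C.o a b c * C.o a b d < 0 ∧ C.o c d a * C.o c d b < 0

@[simp] lemma mirror_crosses (a b c d : V) : C.mirror.Crosses a b c d ↔ C.Crosses a b c d := by
  simp [Crosses]

variable {C}

lemma Crosses.symm {a b c d : V} (h : C.Crosses a b c d) : C.Crosses c d a b := ⟨h.2, h.1⟩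

lemma Crosses.swap_right {a b c d : V} (h : C.Crosses a b c d) : C.Crosses a b d c := by
  refine ⟨by linarith [h.1, mul_comm (C.o a b c) (C.o a b d)], ?_⟩
  rw [C.o_swap_left, C.o_swap_left c d b]; linarith [h.2]

lemma Crosses.swap_left {a b c d : V} (h : C.Crosses a b c d) : C.Crosses b a c d :=
  h.symm.swap_right.symm

lemma Crosses.ne {a b c d : V} (h : C.Crosses a b c d) :
    a ≠ b ∧ a ≠ c ∧ a ≠ d ∧ b ≠ c ∧ b ≠ d ∧ c ≠ d := by
  obtain ⟨h1, h2⟩ := h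
  refine ⟨?_, ?_, ?_, ?_, ?_, ?_⟩ <;> rintro rfl <;> simp at h1 h2

/-- The crossing point of two crossing segments. -/
lemma Crosses.exists_point {a b c d : V} (h : C.Crosses a b c d) :
    ∃ s t : ℝ, 0 < s ∧ s < 1 ∧ 0 < t ∧ t < 1 ∧
      (1 - s) * C.x a + s * C.x b = (1 - t) * C.x c + t * C.x d ∧
      (1 - s) * C.y a + s * C.y b = (1 - t) * C.y c + t * C.y d := by
  obtain ⟨h1, h2⟩ := h
  have key : C.o c d a - C.o c d b = -(C.o a b c - C.o a b d) := by simp only [o_def]; ring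
  have hs : C.o c d a - C.o c d b ≠ 0 := fun h0 => by
    have : C.o c d a = C.o c d b := by linarith
    rw [this] at h2; nlinarith [mul_self_nonneg (C.o c d b)]
  have ht : C.o a b c - C.o a b d ≠ 0 := fun h0 => hs (by rw [key, h0, neg_zero])
  have frac : ∀ p q : ℝ, p * q < 0 → p - q ≠ 0 → 0 < p / (p - q) ∧ p / (p - q) < 1 := by
    intro p q hpq hne
    have e : p / (p - q) = p ^ 2 / (p ^ 2 - p * q) := by
      have : p ≠ 0 := by rintro rfl; simp at hpq
      rw [show p ^ 2 - p * q = p * (p - q) by ring]; field_simp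
    have hp : 0 < p ^ 2 := by
      have : p ≠ 0 := by rintro rfl; simp at hpq
      positivity
    rw [e]
    refine ⟨by apply div_pos <;> linarith, by rw [div_lt_one] <;> linarith⟩
  refine ⟨_, _, (frac _ _ h2 hs).1, (frac _ _ h2 hs).2, (frac _ _ h1 ht).1, (frac _ _ h1 ht).2, ?_, ?_⟩
  all_goals
    have e : C.o a b c / (C.o a b c - C.o a b d) = -C.o a b c / (C.o c d a - C.o c d b) := by
      rw [key, neg_div_neg_eq]
    rw [e]
    field_simp
    simp only [o_def]
    ring

variable (C)

lemma o_combo_right (a b c d : V) (t X Y : ℝ) (hX : X = (1 - t) * C.x c + t * C.x d)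
    (hY : Y = (1 - t) * C.y c + t * C.y d) :
    orient (C.pos a) (C.pos b) (X, Y) = (1 - t) * C.o a b c + t * C.o a b d := by
  subst hX hY; simp only [o_def, orient]; simp only [x, y]; ring

/-- Two different segments with a common point in both relative interiors cross. -/
lemma crosses_of_common_point {a b c d : V} (hab : a ≠ b) (hcd : c ≠ d) (hne : s(a, b) ≠ s(c, d))
    {s t : ℝ} (hs0 : 0 < s) (hs1 : s < 1) (ht0 : 0 < t) (ht1 : t < 1)
    (hx : (1 - s) * C.x a + s * C.x b = (1 - t) * C.x c + t * C.x d)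
    (hy : (1 - s) * C.y a + s * C.y b = (1 - t) * C.y c + t * C.y d) : C.Crosses a b c d := by
  have h1 : (1 - t) * C.o a b c + t * C.o a b d = 0 := by
    rw [← C.o_combo_right a b c d t _ _ hx hy]; simp only [orient, x, y]; ring
  have h2 : (1 - s) * C.o c d a + s * C.o c d b = 0 := by
    rw [← C.o_combo_right c d a b s _ _ hx.symm hy.symm]; simp only [orient, x, y]; ring
  have prod : ∀ (r p q : ℝ), 0 < r → r < 1 → (1 - r) * p + r * q = 0 → p ≠ 0 → p * q < 0 := by
    intro r p q h0 h1 h hp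
    have : r * (p * q) = -((1 - r) * p ^ 2) := by linear_combination p * h
    have h3 : 0 < (1 - r) * p ^ 2 := mul_pos (by linarith) (by positivity)
    by_contra h4
    have := mul_nonneg h0.le (not_lt.1 h4)
    linarith
  have zero : ∀ (r p q : ℝ), 0 < r → r < 1 → (1 - r) * p + r * q = 0 → (p = 0 ↔ q = 0) := by
    intro r p q h0 h1 h
    constructor
    · rintro rfl; have : r * q = 0 := by linarith
      exact (mul_eq_zero.1 this).resolve_left h0.ne'
    · rintro rfl; have : (1 - r) * p = 0 := by linarith
      exact (mul_eq_zero.1 this).resolve_left (by linarith)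
  have z1 := zero _ _ _ ht0 ht1 h1
  have z2 := zero _ _ _ hs0 hs1 h2
  have nz : ∀ e, e ≠ a → e ≠ b → C.o a b e ≠ 0 := fun e h h' => C.o_ne_zero hab h.symm h'.symm
  have nz' : ∀ e, e ≠ c → e ≠ d → C.o c d e ≠ 0 := fun e h h' => C.o_ne_zero hcd h.symm h'.symm
  -- If `c` were on the line `ab`, so would be `d`; general position makes both of them endpoints of
  -- `ab`, and the two segments coincide.
  have hc : C.o a b c ≠ 0 := by
    intro h0
    have hd := z1.1 h0
    have hc' : c = a ∨ c = b := by by_contra h; push Not at h; exact nz c h.1 h.2 h0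
    have hd' : d = a ∨ d = b := by by_contra h; push Not at h; exact nz d h.1 h.2 hd
    rcases hc' with rfl | rfl <;> rcases hd' with rfl | rfl <;> simp_all [Sym2.eq_swap]
  have ha : C.o c d a ≠ 0 := by
    intro h0
    have hd := z2.1 h0
    have hc' : a = c ∨ a = d := by by_contra h; push Not at h; exact nz' a h.1 h.2 h0
    rcases hc' with rfl | rfl
    · simp at hc
    · exact hc (z1.2 (by simp))
  exact ⟨prod _ _ _ ht0 ht1 h1 hc, prod _ _ _ hs0 hs1 h2 ha⟩

end PointConfig

/-! ### Rerouting a segment to lose a crossing, and neighbours in half-planes. -/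

/-- A segment entering the corner at the origin through the positive second axis, and passing
through a point `m` of the first quadrant beyond the line `cd`, meets the segment `cd`. -/
lemma exists_common_of_beyond {a1 a2 b1 b2 c1 c2 d1 d2 m1 m2 μ : ℝ} (ha1 : 0 < a1) (hb1 : b1 < 0)
    (hY : 0 < a1 * b2 - a2 * b1) (hY1 : a1 * b2 - a2 * b1 < a1 - b1) (hc1 : c1 ≤ 0) (hc2 : 0 < c2)
    (hd2 : d2 < 0) (hE : 0 < d1 * c2 - d2 * c1) (hp : 0 ≤ d1 * c2 - d2 * c1 + c1 - d1)
    (hμ0 : 0 ≤ μ) (hμ1 : μ < 1) (hm1 : m1 = (1 - μ) * a1 + μ * b1)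
    (hm2 : m2 = (1 - μ) * a2 + μ * b2) (hm1pos : 0 < m1) (hm2pos : 0 ≤ m2)
    (hg : (c1 - d1) * (m2 - d2) - (c2 - d2) * (m1 - d1) < 0) :
    ∃ s t : ℝ, 0 < s ∧ s < 1 ∧ 0 < t ∧ t < 1 ∧ (1 - s) * a1 + s * b1 = (1 - t) * c1 + t * d1 ∧
      (1 - s) * a2 + s * b2 = (1 - t) * c2 + t * d2 := by
  have hab : 0 < a1 - b1 := by linarith
  obtain ⟨ν, hν⟩ : ∃ ν, ν = a1 / (a1 - b1) := ⟨_, rfl⟩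
  have hν0 : 0 < ν := hν ▸ div_pos ha1 hab
  have hν1 : ν < 1 := by rw [hν, div_lt_one hab]; linarith
  -- The segment `ab` meets the second axis at `(0, w)`, with parameter `ν`.
  obtain ⟨w, hw⟩ : ∃ w, w = (a1 * b2 - a2 * b1) / (a1 - b1) := ⟨_, rfl⟩
  have hw0 : 0 < w := hw ▸ div_pos hY hab
  have hw1 : w < 1 := by rw [hw, div_lt_one hab]; linarith
  have hνx : (1 - ν) * a1 + ν * b1 = 0 := by rw [hν]; field_simp; ring
  have hνy : (1 - ν) * a2 + ν * b2 = w := by rw [hν, hw]; field_simp; ring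
  -- `(0, w)` is strictly on the origin's side of the line `cd`, since the origin is and `(0, 1)` is
  -- at least weakly so.
  have hgw : 0 < (c1 - d1) * (w - d2) - (c2 - d2) * (0 - d1) := by
    have : (c1 - d1) * (w - d2) - (c2 - d2) * (0 - d1) =
      (1 - w) * (d1 * c2 - d2 * c1) + w * (d1 * c2 - d2 * c1 + c1 - d1) := by ring
    rw [this]
    have := mul_pos (sub_pos.2 hw1) hE
    have := mul_nonneg hw0.le hp
    linarith
  obtain ⟨G, hG⟩ : ∃ G, G = (c1 - d1) * (m2 - d2) - (c2 - d2) * (m1 - d1) := ⟨_, rfl⟩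
  obtain ⟨K, hK⟩ : ∃ K, K = (c1 - d1) * (w - d2) - (c2 - d2) * (0 - d1) := ⟨_, rfl⟩
  rw [← hG] at hg; rw [← hK] at hgw
  obtain ⟨τ, hτ⟩ : ∃ τ, τ = -G / (K - G) := ⟨_, rfl⟩
  have hKG : 0 < K - G := by linarith
  have hτ0 : 0 < τ := hτ ▸ div_pos (by linarith) hKG
  have hτ1 : τ < 1 := by rw [hτ, div_lt_one hKG]; linarith
  have hτz : (1 - τ) * G + τ * K = 0 := by rw [hτ]; field_simp; ring
  -- `n` is the point of the line `cd` between `m` and `(0, w)`. It lies in the open first quadrant,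
  -- where that line runs inside the segment because `c1 ≤ 0` and `d2 < 0`.
  obtain ⟨n1, hn1⟩ : ∃ n1, n1 = (1 - τ) * m1 := ⟨_, rfl⟩
  obtain ⟨n2, hn2⟩ : ∃ n2, n2 = (1 - τ) * m2 + τ * w := ⟨_, rfl⟩
  have hn1pos : 0 < n1 := hn1 ▸ mul_pos (by linarith) hm1pos
  have hn2pos : 0 < n2 := by
    have := mul_nonneg (sub_nonneg.2 hτ1.le) hm2pos
    have := mul_pos hτ0 hw0
    linarith
  have hgn : (c1 - d1) * (n2 - d2) - (c2 - d2) * (n1 - d1) = 0 := by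
    rw [← hτz, hG, hK, hn1, hn2]; ring
  have hd1 : 0 < d1 := by
    have h1 : 0 ≤ d2 * c1 := mul_nonneg_of_nonpos_of_nonpos hd2.le hc1
    by_contra h
    have := mul_nonneg_of_nonpos_of_nonpos (not_lt.1 h) (neg_nonpos.2 hc2.le)
    linarith
  have hdc : 0 < d1 - c1 := by linarith
  obtain ⟨t, ht⟩ : ∃ t, t = (n1 - c1) / (d1 - c1) := ⟨_, rfl⟩
  have htx : n1 = (1 - t) * c1 + t * d1 := by rw [ht]; field_simp; ring
  have hty : n2 = (1 - t) * c2 + t * d2 := by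
    apply mul_left_cancel₀ hdc.ne'
    rw [htx] at hgn
    linear_combination -hgn
  have ht0 : 0 < t := ht ▸ div_pos (by linarith) hdc
  have ht1 : t < 1 := by
    by_contra h
    have := mul_nonneg (sub_nonneg.2 (not_lt.1 h)) (by linarith : (0 : ℝ) ≤ c2 - d2)
    linarith
  refine ⟨(1 - τ) * μ + τ * ν, t, ?_, ?_, ht0, ht1, ?_, ?_⟩
  · have := mul_nonneg (sub_nonneg.2 hτ1.le) hμ0
    have := mul_pos hτ0 hν0
    linarith
  · have := mul_pos (sub_pos.2 hτ1) (sub_pos.2 hμ1)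
    have := mul_pos hτ0 (sub_pos.2 hν1)
    linarith
  · rw [← htx, hn1, hm1]; linear_combination τ * hνx
  · rw [← hty, hn2, hm2]; linear_combination τ * hνy

namespace PointConfig

variable {V : Type*} (C : PointConfig V)

/-- Coordinates of `q` in the affine frame `v, z, p`. -/
lemma frame (v z p q r : V) (hD : C.o v z p ≠ 0) :
    C.o v q r = C.o v z p * (C.o v q p / C.o v z p * (C.o v z r / C.o v z p) -
      C.o v z q / C.o v z p * (C.o v r p / C.o v z p)) := by
  field_simp
  simp only [o_def]
  ring

lemma o_eq_of_origin (v a b c : V) : C.o a b c = C.o v a b + C.o v b c - C.o v a c := by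
  simp only [o_def]; ring

lemma frame_x (v z p q : V) (hD : C.o v z p ≠ 0) :
    C.x q = C.x v + C.o v q p / C.o v z p * (C.x z - C.x v) +
      C.o v z q / C.o v z p * (C.x p - C.x v) := by
  field_simp
  simp only [o_def]
  ring

lemma frame_y (v z p q : V) (hD : C.o v z p ≠ 0) :
    C.y q = C.y v + C.o v q p / C.o v z p * (C.y z - C.y v) +
      C.o v z q / C.o v z p * (C.y p - C.y v) := by
  field_simp
  simp only [o_def]
  ring

/-- Let `x` be the crossing point of `vz` and `cd`. The point `p` is the first one in the triangle
`v x c` met when `vz` rotates towards `c`. The part of this triangle between `vz` and `vp` contains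
no labelled point, so an edge entering it through `vp` must leave it; not being allowed to cross
`cd`, it crosses `vz`. -/
lemma exists_fewer_crossings_of_pos [Finite V] {v z c d : V} (h : C.Crosses v z c d)
    (hc : 0 < C.o v z c) :
    ∃ p, p ≠ v ∧
      (∃ α β : ℝ, 0 ≤ α ∧ 0 < β ∧ ∀ u, C.o v u p = α * C.o v u z + β * C.o v u c) ∧
      ¬ C.Crosses v p c d ∧ ∀ a b, ¬ C.Crosses a b c d → C.Crosses v p a b → C.Crosses v z a b := by
  classical
  have := Fintype.ofFinite V
  have hd : C.o v z d < 0 := by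
    by_contra h'; have := mul_nonneg hc.le (not_lt.1 h'); linarith [h.1]
  have hdcv : 0 < C.o d c v ∧ C.o d c z < 0 := by
    have e : C.o d c v - C.o d c z = C.o v z c - C.o v z d := by simp only [o_def]; ring
    have h2 := h.2
    rw [C.o_swap_left d c v, C.o_swap_left d c z] at h2
    constructor
    · by_contra h'
      have := mul_nonneg_of_nonpos_of_nonpos (not_lt.1 h') (by linarith : C.o d c z ≤ 0)
      linarith
    · by_contra h'
      have := mul_nonneg (by linarith : 0 ≤ C.o d c v) (not_lt.1 h')
      linarith
  obtain ⟨hv, hz⟩ := hdcv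
  obtain ⟨p, hpR, hpmin⟩ := C.exists_first (v := v) (u := z)
    (Finset.univ.filter fun p => 0 < C.o v z p ∧ 0 ≤ C.o d c p ∧ 0 ≤ C.o v p c)
    ⟨c, by simp [hc]⟩ (fun p hp => (Finset.mem_filter.1 hp).2.1)
  simp only [Finset.mem_filter, Finset.mem_univ, true_and] at hpR hpmin
  obtain ⟨hp1, hp2, hp3⟩ := hpR
  refine ⟨p, (C.ne_of_o_ne_zero hp1.ne').2.1.symm,
    ⟨C.o v p c / C.o v z c, C.o v z p / C.o v z c, div_nonneg hp3 hc.le, div_pos hp1 hc, ?_⟩, ?_, ?_⟩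
  · intro u
    field_simp
    have := C.plucker v u p z c
    have e := C.o_swap v z p
    rw [e] at this
    linarith
  · intro hX
    have h2 := hX.2
    rw [C.o_swap_left d c v, C.o_swap_left d c p] at h2
    have := mul_nonneg hv.le hp2
    linarith
  -- By symmetry `a` may be taken on the same side of `vp` as `z`.
  · have main : ∀ a b, ¬ C.Crosses a b c d → C.Crosses v p a b → C.o v p a < 0 →
        C.Crosses v z a b := by
      intro a b hncd hX ha
      have hb : 0 < C.o v p b := by
        by_contra h'
        have := mul_nonneg_of_nonpos_of_nonpos ha.le (not_lt.1 h'); linarith [hX.1]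
      have habv : 0 < C.o a b v ∧ C.o a b p < 0 := by
        have e : C.o a b v - C.o a b p = C.o v p b - C.o v p a := by simp only [o_def]; ring
        have h2 := hX.2
        constructor
        · by_contra h'
          have := mul_nonneg_of_nonpos_of_nonpos (not_lt.1 h') (by linarith : C.o a b p ≤ 0)
          linarith
        · by_contra h'
          have := mul_nonneg (by linarith : 0 ≤ C.o a b v) (not_lt.1 h')
          linarith
      obtain ⟨hav, hap⟩ := habv
      have hD : C.o v z p ≠ 0 := hp1.ne'
      -- Otherwise `a` would lie in the triangle and precede `p`.
      have haR : 0 ≤ C.o v z a → C.o d c a < 0 := by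
        intro h0
        by_contra hneg
        have hne : C.o v z a ≠ 0 := by
          intro h1
          have hva : v ≠ a := hX.ne.2.1
          have hvz : v ≠ z := h.ne.1
          have : z = a := by
            by_contra hza; exact C.o_ne_zero hvz hva hza h1
          subst this
          exact hneg hz
        have h0' : 0 < C.o v z a := lt_of_le_of_ne h0 (Ne.symm hne)
        have hac : 0 ≤ C.o v a c := by
          have := C.plucker v z p a c
          by_contra hn
          have h1 := mul_neg_of_pos_of_neg hp1 (not_le.1 hn)
          have h2 := mul_nonneg h0 hp3
          have h3 := mul_neg_of_pos_of_neg hc ha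
          linarith
        have := hpmin a ⟨h0', not_lt.1 hneg, hac⟩
        linarith
      have hab := hX.ne.2.2.2.2.2
      have hcd := h.ne.2.2.2.2.2
      have hne : s(a, b) ≠ s(c, d) := by
        intro he
        rw [Sym2.eq_iff] at he
        have h2 := hX.2
        have hcd' : 0 ≤ C.o d c v * C.o d c p := mul_nonneg hv.le hp2
        rcases he with ⟨rfl, rfl⟩ | ⟨rfl, rfl⟩
        · rw [C.o_swap_left b a v, C.o_swap_left b a p] at h2; linarith
        · linarith
      -- coordinates in the frame `v, z, p`
      set D := C.o v z p with hDdef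
      obtain ⟨α, hα⟩ : ∃ α : V → ℝ, ∀ q, α q = C.o v q p / D := ⟨_, fun _ => rfl⟩
      obtain ⟨β, hβ⟩ : ∃ β : V → ℝ, ∀ q, β q = C.o v z q / D := ⟨_, fun _ => rfl⟩
      have hfr : ∀ q r, C.o v q r = D * (α q * β r - β q * α r) := by
        intro q r; rw [hα, hβ, hα, hβ]; exact C.frame v z p q r hD
      have ho : ∀ q r s, C.o q r s = D * ((α r - α q) * (β s - β q) - (β r - β q) * (α s - α q)) := by
        intro q r s; rw [C.o_eq_of_origin v, hfr, hfr, hfr]; ring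
      have hαv : α v = 0 := by simp [hα]
      have hβv : β v = 0 := by simp [hβ]
      have hαz : α z = 1 := by rw [hα]; exact div_self hD
      have hβz : β z = 0 := by simp [hβ]
      have hαp : α p = 0 := by simp [hα]
      have hβp : β p = 1 := by rw [hβ]; exact div_self hD
      have posD : ∀ t, 0 < D * t ↔ 0 < t := fun t => mul_pos_iff_of_pos_left hp1
      have nonnegD : ∀ t, 0 ≤ D * t ↔ 0 ≤ t := fun t => mul_nonneg_iff_of_pos_left hp1
      have negD : ∀ t, D * t < 0 ↔ t < 0 := fun t => by
        rw [← not_le, nonnegD, not_le]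
      have ha1 : 0 < α a := by
        have := ha; rw [ho, negD, hαv, hβv, hαp, hβp] at this; linarith
      have hb1 : α b < 0 := by
        have := hb; rw [ho, posD, hαv, hβv, hαp, hβp] at this; linarith
      have hc1 : α c ≤ 0 := by
        have := hp3; rw [ho, nonnegD, hαv, hβv, hαp, hβp] at this; linarith
      have hc2 : 0 < β c := by rw [hβ]; exact div_pos hc hp1
      have hd2 : β d < 0 := by rw [hβ]; exact div_neg_of_neg_of_pos hd hp1
      have hY : 0 < α a * β b - β a * α b := by
        have := hav; rw [ho, posD, hαv, hβv] at this; linarith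
      have hY1 : α a * β b - β a * α b < α a - α b := by
        have := hap; rw [ho, negD, hαp, hβp] at this; linarith
      have hE : 0 < α d * β c - β d * α c := by
        have := hv; rw [ho, posD, hαv, hβv] at this; linarith
      have hEz : α d * β c - β d * α c < β c - β d := by
        have := hz; rw [ho, negD, hαz, hβz] at this; linarith
      have hEp : 0 ≤ α d * β c - β d * α c + α c - α d := by
        have := hp2; rw [ho, nonnegD, hαp, hβp] at this; linarith
      have hno : ¬ ∃ s t : ℝ, 0 < s ∧ s < 1 ∧ 0 < t ∧ t < 1 ∧
          (1 - s) * α a + s * α b = (1 - t) * α c + t * α d ∧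
          (1 - s) * β a + s * β b = (1 - t) * β c + t * β d := by
        rintro ⟨s, t, hs0, hs1, ht0, ht1, hx, hy⟩
        refine hncd (C.crosses_of_common_point hab hcd hne hs0 hs1 ht0 ht1 ?_ ?_)
        · have e : ∀ q, C.x q = C.x v + α q * (C.x z - C.x v) + β q * (C.x p - C.x v) := by
            intro q; rw [hα, hβ]; exact C.frame_x v z p q hD
          rw [e a, e b, e c, e d]
          linear_combination (C.x z - C.x v) * hx + (C.x p - C.x v) * hy
        · have e : ∀ q, C.y q = C.y v + α q * (C.y z - C.y v) + β q * (C.y p - C.y v) := by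
            intro q; rw [hα, hβ]; exact C.frame_y v z p q hD
          rw [e a, e b, e c, e d]
          linear_combination (C.y z - C.y v) * hx + (C.y p - C.y v) * hy
      -- If `a` were not strictly on the other side of the line `vz`, it would be beyond `cd` by
      -- `haR`, and `ab` would cross `cd`.
      have ha2 : β a < 0 := by
        by_contra hn
        have hn' := not_lt.1 hn
        have h0 : C.o d c a < 0 := haR (by
          have : C.o v z a = D * β a := by rw [hβ]; field_simp
          rw [this, nonnegD]; exact hn')
        rw [ho, negD] at h0
        exact hno (exists_common_of_beyond (μ := 0) ha1 hb1 hY hY1 hc1 hc2 hd2 hE hEp le_rfl one_pos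
          (by ring) (by ring) ha1 hn' h0)
      have hb2 : 0 < β b := by
        have h1 := mul_pos_of_neg_of_neg ha2 hb1
        by_contra hn
        have := mul_nonneg ha1.le (neg_nonneg.2 (not_lt.1 hn))
        linarith
      have hba : 0 < β b - β a := by linarith
      -- The line `vz` is met by `cd` before `z`. Were it met by `ab` at `z` or later, that meeting
      -- point would be beyond `cd`, again forcing a crossing with `cd`.
      have hYz : α a * β b - β a * α b < β b - β a := by
        by_contra hn
        have hn' := not_lt.1 hn
        have hm : 1 ≤ (α a * β b - β a * α b) / (β b - β a) := by rw [le_div_iff₀ hba]; linarith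
        refine hno (exists_common_of_beyond (μ := -β a / (β b - β a))
          (m1 := (α a * β b - β a * α b) / (β b - β a)) (m2 := 0)
          ha1 hb1 hY hY1 hc1 hc2 hd2 hE hEp (div_nonneg (by linarith) hba.le)
          (by rw [div_lt_one hba]; linarith) (by field_simp; ring) (by field_simp; ring)
          (by linarith) le_rfl ?_)
        have := mul_le_mul_of_nonneg_left hm (by linarith : (0:ℝ) ≤ β c - β d)
        linarith
      constructor
      · rw [ho, ho v z b, hαv, hβv, hαz, hβz]
        have := mul_pos hp1 hb2
        have h3 := mul_pos hp1 (neg_pos.2 ha2)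
        have := mul_pos this h3
        linarith
      · have h1 : C.o a b z < 0 := by rw [ho, negD, hαz, hβz]; linarith
        exact mul_neg_of_pos_of_neg hav h1
    intro a b hncd hX
    rcases lt_trichotomy (C.o v p a) 0 with ha | ha | ha
    · exact main a b hncd hX ha
    · have := hX.1; rw [ha] at this; simp at this
    · have hb : C.o v p b < 0 := by
        by_contra h'
        have := mul_nonneg ha.le (not_lt.1 h'); linarith [hX.1]
      exact (main b a (fun h => hncd h.swap_left) hX.swap_right hb).swap_right

/-- If the segment `vz` is crossed by `cd`, then some point `p` in the cone at `v` spanned by `z`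
and `c` has the property that `vp` is crossed only by segments crossing `vz`, and not by `cd`. -/
lemma exists_fewer_crossings [Finite V] {v z c d : V} (h : C.Crosses v z c d) :
    ∃ p, p ≠ v ∧
      (∃ α β : ℝ, 0 ≤ α ∧ 0 < β ∧ ∀ u, C.o v u p = α * C.o v u z + β * C.o v u c) ∧
      ¬ C.Crosses v p c d ∧ ∀ a b, ¬ C.Crosses a b c d → C.Crosses v p a b → C.Crosses v z a b := by
  rcases lt_trichotomy (C.o v z c) 0 with hc | hc | hc
  · obtain ⟨p, h1, ⟨α, β, hα, hβ, h2⟩, h3, h4⟩ := C.mirror.exists_fewer_crossings_of_pos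
      (v := v) (z := z) (c := c) (d := d) (by simpa using h) (by simpa using hc)
    refine ⟨p, h1, ⟨α, β, hα, hβ, fun u => ?_⟩, by simpa using h3, fun a b => by simpa using h4 a b⟩
    have := h2 u
    simp only [mirror_o] at this
    linarith
  · have := h.1; rw [hc] at this; simp at this
  · exact C.exists_fewer_crossings_of_pos h hc

/-- No two edges of the graph cross. -/
def CrossingFree (G : SimpleGraph V) : Prop :=
  ∀ a b c d, G.Adj a b → G.Adj c d → ¬ C.Crosses a b c d

/-- Maximal crossing-free graphs. -/
def Triangulation (T : SimpleGraph V) : Prop := Maximal C.CrossingFree T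

variable {C}

lemma CrossingFree.mono {G H : SimpleGraph V} (hH : C.CrossingFree H) (h : G ≤ H) :
    C.CrossingFree G := fun a b c d h1 h2 => hH a b c d (h h1) (h h2)

lemma CrossingFree.sup_edge {G : SimpleGraph V} (hG : C.CrossingFree G) {v z : V}
    (h : ∀ c d, G.Adj c d → ¬ C.Crosses v z c d) : C.CrossingFree (G ⊔ SimpleGraph.edge v z) := by
  have adj : ∀ a b, (G ⊔ SimpleGraph.edge v z).Adj a b →
      G.Adj a b ∨ (a = v ∧ b = z) ∨ (a = z ∧ b = v) := by
    intro a b hab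
    rw [SimpleGraph.sup_adj, SimpleGraph.edge_adj] at hab
    tauto
  intro a b c d hab hcd hX
  rcases adj a b hab with h1 | ⟨rfl, rfl⟩ | ⟨rfl, rfl⟩ <;>
    rcases adj c d hcd with h2 | ⟨rfl, rfl⟩ | ⟨rfl, rfl⟩
  · exact hG a b c d h1 h2 hX
  · exact h a b h1 hX.symm
  · exact h a b h1 hX.symm.swap_left
  · exact h c d h2 hX
  · exact hX.ne.2.1 rfl
  · exact hX.ne.2.2.1 rfl
  · exact h c d h2 hX.swap_left
  · exact hX.ne.2.2.1 rfl
  · exact hX.ne.2.1 rfl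

lemma Triangulation.adj_of_not_crosses {T : SimpleGraph V} (hT : C.Triangulation T) {v z : V}
    (hvz : v ≠ z) (h : ∀ c d, T.Adj c d → ¬ C.Crosses v z c d) : T.Adj v z := by
  have h1 := hT.2 (hT.1.sup_edge h) le_sup_left
  apply h1
  rw [SimpleGraph.sup_adj, SimpleGraph.edge_adj]
  exact Or.inr ⟨Or.inl ⟨rfl, rfl⟩, hvz⟩

/-- In a triangulation, an open half-plane bounded by a line through `v` and containing a point
contains a neighbour of `v`. -/
lemma Triangulation.exists_adj_left [Finite V] {T : SimpleGraph V} (hT : C.Triangulation T)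
    {v u z : V} (hz : 0 < C.o v u z) : ∃ z', T.Adj v z' ∧ 0 < C.o v u z' := by
  classical
  have := Fintype.ofFinite V
  -- Choose `z₀` in the half-plane so that `vz₀` is crossed by as few edges as possible; a crossing
  -- edge with an endpoint in the half-plane would allow a better choice in the cone spanned by that
  -- endpoint and `z₀`.
  let cr : V → Finset (V × V) := fun z =>
    Finset.univ.filter fun e => T.Adj e.1 e.2 ∧ C.Crosses v z e.1 e.2
  obtain ⟨z₀, hz₀, hmin⟩ := (Finset.univ.filter fun z => 0 < C.o v u z).exists_min_image
    (fun z => (cr z).card) ⟨z, by simpa using hz⟩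
  simp only [Finset.mem_filter, Finset.mem_univ, true_and] at hz₀ hmin
  refine ⟨z₀, hT.adj_of_not_crosses (C.ne_of_o_ne_zero hz₀.ne').2.1 ?_, hz₀⟩
  have main : ∀ c d, T.Adj c d → C.Crosses v z₀ c d → ¬ 0 < C.o v u c := by
    intro c d hcd hX hc
    obtain ⟨p, -, ⟨α, β, hα, hβ, hp⟩, hn, hsub⟩ := C.exists_fewer_crossings hX
    have hpu : 0 < C.o v u p := by
      rw [hp]
      have := mul_nonneg hα hz₀.le
      have := mul_pos hβ hc
      linarith
    refine absurd (hmin p hpu) (not_le.2 (Finset.card_lt_card ?_))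
    refine Finset.ssubset_iff_of_subset ?_ |>.2 ⟨(c, d), ?_, ?_⟩
    · intro e he
      simp only [cr, Finset.mem_filter, Finset.mem_univ, true_and] at he ⊢
      exact ⟨he.1, hsub _ _ (hT.1 _ _ _ _ he.1 hcd) he.2⟩
    · simpa [cr] using ⟨hcd, hX⟩
    · simpa [cr] using fun _ => hn
  intro c d hcd hX
  have h1 := main c d hcd hX
  have h2 := main d c hcd.symm hX.swap_right
  -- The crossing point is in the open half-plane, hence so is `c` or `d`.
  obtain ⟨s, t, hs0, hs1, ht0, ht1, hx, hy⟩ := hX.exists_point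
  have e1 := C.o_combo_right v u v z₀ s _ _ rfl rfl
  have e2 := C.o_combo_right v u c d t _ _ hx hy
  rw [e1, C.o_self_outer] at e2
  have := mul_pos hs0 hz₀
  have := mul_nonneg (sub_nonneg.2 ht1.le) (neg_nonneg.2 (not_lt.1 h1))
  have := mul_nonneg ht0.le (neg_nonneg.2 (not_lt.1 h2))
  linarith

end PointConfig

/-! ### Empty triangles of a triangulation. -/

namespace PointConfig

variable {V : Type*} (C : PointConfig V)

/-- The coordinate of `a` along `vw` in the affine frame with origin `v` and axes `vw`, `vq`. -/
noncomputable def coord (v w q a : V) : ℝ := C.o v a q / C.o v w q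

lemma coord_swap (v w q a : V) : C.coord v q w a = C.o v w a / C.o v w q := by
  rw [coord, C.o_swap v w a, C.o_swap v w q, neg_div_neg_eq]

@[simp] lemma coord_origin (v w q : V) : C.coord v w q v = 0 := by simp [coord]

@[simp] lemma coord_outer (v w q : V) : C.coord v w q q = 0 := by simp [coord]

lemma coord_self {v w q : V} (h : C.o v w q ≠ 0) : C.coord v w q w = 1 := div_self h

lemma coord_combo {v w q a b c d : V} {s t : ℝ}
    (hx : (1 - s) * C.x a + s * C.x b = (1 - t) * C.x c + t * C.x d)
    (hy : (1 - s) * C.y a + s * C.y b = (1 - t) * C.y c + t * C.y d) :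
    (1 - s) * C.coord v w q a + s * C.coord v w q b =
      (1 - t) * C.coord v w q c + t * C.coord v w q d := by
  have h : (1 - s) * C.o v a q + s * C.o v b q = (1 - t) * C.o v c q + t * C.o v d q := by
    simp only [o_def]
    linear_combination (C.y q - C.y v) * hx - (C.x q - C.x v) * hy
  simp only [coord]
  linear_combination (1 / C.o v w q) * h

lemma coord_eq_zero_iff {v w q a : V} (h : C.o v w q ≠ 0) :
    C.coord v w q a = 0 ↔ a = v ∨ a = q := by
  rw [coord, div_eq_zero_iff, or_iff_left h]
  constructor
  · intro h0
    by_contra hne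
    push Not at hne
    exact C.o_ne_zero (Ne.symm hne.1) (C.ne_of_o_ne_zero h).2.1 hne.2 h0
  · rintro (rfl | rfl) <;> simp

/-- On the way from `c` to the point `x` the segment meets the axis `vq` at height `s`. The
determinant hypothesis gives `0 < s`; `s < 1` holds since neither `c` nor `x` is beyond the line
`wq`. -/
lemma crosses_side {v w q c d : V} (hD : C.o v w q ≠ 0) (hcv : c ≠ v) (hdv : d ≠ v) (hcd : c ≠ d)
    {t x1 x2 : ℝ} (ht0 : 0 < t) (ht1 : t < 1)
    (hx1 : x1 = (1 - t) * C.coord v w q c + t * C.coord v w q d)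
    (hx2 : x2 = (1 - t) * C.coord v q w c + t * C.coord v q w d)
    (hc : C.coord v w q c < 0) (hx1pos : 0 < x1)
    (hpos : 0 < x1 * C.coord v q w c - C.coord v w q c * x2)
    (hc1 : C.coord v w q c + C.coord v q w c < 1) (hx : x1 + x2 ≤ 1) : C.Crosses v q c d := by
  obtain ⟨c1, hc1'⟩ : ∃ r, r = C.coord v w q c := ⟨_, rfl⟩
  obtain ⟨c2, hc2'⟩ : ∃ r, r = C.coord v q w c := ⟨_, rfl⟩
  obtain ⟨d1, hd1'⟩ : ∃ r, r = C.coord v w q d := ⟨_, rfl⟩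
  obtain ⟨d2, hd2'⟩ : ∃ r, r = C.coord v q w d := ⟨_, rfl⟩
  rw [← hc1', ← hd1'] at hx1
  rw [← hc2', ← hd2'] at hx2
  rw [← hc1', ← hc2'] at hpos hc1
  rw [← hc1'] at hc
  have hm : 0 < x1 - c1 := by linarith
  obtain ⟨μ, hμ⟩ : ∃ μ, μ = -c1 / (x1 - c1) := ⟨_, rfl⟩
  obtain ⟨s, hs⟩ : ∃ s, s = (x1 * c2 - c1 * x2) / (x1 - c1) := ⟨_, rfl⟩
  have hμ0 : 0 < μ := hμ ▸ div_pos (by linarith) hm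
  have hμ1 : μ < 1 := by rw [hμ, div_lt_one hm]; linarith
  have e1 : 0 = (1 - μ) * c1 + μ * x1 := by rw [hμ]; field_simp; ring
  have e2 : s = (1 - μ) * c2 + μ * x2 := by rw [hμ, hs]; field_simp; ring
  have hs0 : 0 < s := hs ▸ div_pos hpos hm
  have hs1 : s < 1 := by
    have h1 := mul_pos (sub_pos.2 hμ1) (sub_pos.2 hc1)
    have h2 := mul_nonneg hμ0.le (sub_nonneg.2 hx)
    linarith
  have hμt : μ * t < 1 := by
    have := mul_pos hμ0 (sub_pos.2 ht1); linarith
  have hvq := (C.ne_of_o_ne_zero hD).2.1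
  have g1 : 0 = (1 - μ * t) * c1 + μ * t * d1 := by rw [hx1] at e1; linarith
  have g2 : s = (1 - μ * t) * c2 + μ * t * d2 := by rw [hx2] at e2; linarith
  refine C.crosses_of_common_point hvq hcd (fun h => ?_) hs0 hs1 (mul_pos hμ0 ht0) hμt ?_ ?_
  · rw [Sym2.eq_iff] at h
    rcases h with ⟨rfl, -⟩ | ⟨rfl, -⟩ <;> contradiction
  · have e : ∀ a, C.x a = C.x v + C.coord v w q a * (C.x w - C.x v) +
        C.coord v q w a * (C.x q - C.x v) := by
      intro a; rw [C.coord_swap v w q a]; exact C.frame_x v w q a hD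
    rw [e c, e d, ← hc1', ← hc2', ← hd1', ← hd2']
    linear_combination (C.x w - C.x v) * g1 + (C.x q - C.x v) * g2
  · have e : ∀ a, C.y a = C.y v + C.coord v w q a * (C.y w - C.y v) +
        C.coord v q w a * (C.y q - C.y v) := by
      intro a; rw [C.coord_swap v w q a]; exact C.frame_y v w q a hD
    rw [e c, e d, ← hc1', ← hc2', ← hd1', ← hd2']
    linear_combination (C.y w - C.y v) * g1 + (C.y q - C.y v) * g2

/-- A segment leaving the triangle `v w q` through the two sides at `v` crosses one of them. -/
lemma crosses_side_or {v w q c d : V} (hD : C.o v w q ≠ 0) (hcv : c ≠ v) (hdv : d ≠ v)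
    (hcd : c ≠ d) {t x1 x2 : ℝ} (ht0 : 0 < t) (ht1 : t < 1)
    (hx1 : x1 = (1 - t) * C.coord v w q c + t * C.coord v w q d)
    (hx2 : x2 = (1 - t) * C.coord v q w c + t * C.coord v q w d)
    (hx1pos : 0 < x1) (hx2pos : 0 < x2) (hx : x1 + x2 ≤ 1)
    (hc1 : C.coord v w q c + C.coord v q w c < 1)
    (hc : C.coord v w q c ≤ 0 ∨ C.coord v q w c ≤ 0) :
    C.Crosses v w c d ∨ C.Crosses v q c d := by
  have hD' : C.o v q w ≠ 0 := by rw [C.o_swap]; exact neg_ne_zero.2 hD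
  have n1 : C.coord v w q c ≠ 0 := by
    rw [Ne, C.coord_eq_zero_iff hD]
    rintro (h | rfl)
    · exact hcv h
    · rw [C.coord_outer, C.coord_self hD'] at hc1; linarith
  have n2 : C.coord v q w c ≠ 0 := by
    rw [Ne, C.coord_eq_zero_iff hD']
    rintro (h | rfl)
    · exact hcv h
    · rw [C.coord_outer, C.coord_self hD] at hc1; linarith
  -- Vanishing would put `v` on the line `cd`. When both coordinates of `c` are negative, this sign
  -- tells on which side of `v` the segment passes, hence which side of the triangle it crosses.
  have n3 : x1 * C.coord v q w c - C.coord v w q c * x2 ≠ 0 := by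
    intro h0
    have h1 : C.o v c d = C.o v w q * (C.coord v w q c * C.coord v q w d -
        C.coord v q w c * C.coord v w q d) := by
      rw [C.coord_swap v w q c, C.coord_swap v w q d]; exact C.frame v w q c d hD
    have h2 : C.coord v w q c * C.coord v q w d - C.coord v q w c * C.coord v w q d = 0 := by
      rw [hx1, hx2] at h0
      apply mul_left_cancel₀ ht0.ne'
      linear_combination -h0
    rw [h2, mul_zero] at h1
    exact C.o_ne_zero hcv.symm hdv.symm hcd h1
  have L := C.crosses_side hD hcv hdv hcd ht0 ht1 hx1 hx2
  have R := C.crosses_side hD' hcv hdv hcd ht0 ht1 hx2 hx1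
  rcases lt_or_gt_of_ne n1 with k1 | k1 <;> rcases lt_or_gt_of_ne n2 with k2 | k2
  · rcases lt_or_gt_of_ne n3 with k3 | k3
    · exact Or.inl (R k2 hx2pos (by linarith) (by linarith) (by linarith))
    · exact Or.inr (L k1 hx1pos k3 hc1 hx)
  · refine Or.inr (L k1 hx1pos ?_ hc1 hx)
    have := mul_pos hx1pos k2
    have := mul_pos (neg_pos.2 k1) hx2pos
    linarith
  · refine Or.inl (R k2 hx2pos ?_ (by linarith) (by linarith))
    have := mul_pos hx2pos k1
    have := mul_pos (neg_pos.2 k2) hx1pos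
    linarith
  · rcases hc with h | h <;> linarith

/-- `a b c` is a counterclockwise triangle of `T` containing no point in its interior. -/
def IsTri (T : SimpleGraph V) (a b c : V) : Prop :=
  T.Adj a b ∧ T.Adj b c ∧ T.Adj c a ∧ 0 < C.o a b c ∧
    ∀ s, ¬ (0 < C.o a b s ∧ 0 < C.o b c s ∧ 0 < C.o c a s)

variable {C}

lemma IsTri.rot {T : SimpleGraph V} {a b c : V} (h : C.IsTri T a b c) : C.IsTri T b c a := by
  obtain ⟨h1, h2, h3, h4, h5⟩ := h
  exact ⟨h2, h3, h1, by rwa [C.o_rot], fun s hs => h5 s ⟨hs.2.2, hs.1, hs.2.1⟩⟩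

/-- The point `p` cannot be inside the empty triangle, so it is beyond `bc`, and then `ap` crosses
`bc`. -/
lemma IsTri.not_adj_in_wedge {T : SimpleGraph V} (hT : C.CrossingFree T) {a b c p : V}
    (h : C.IsTri T a b c) (hp : T.Adj a p) (h1 : 0 < C.o a b p) (h2 : 0 < C.o a p c) : False := by
  obtain ⟨hab, hbc, hca, hpos, hemp⟩ := h
  have e : C.o c a p = C.o a p c := by rw [← C.o_rot]
  have h3 : C.o b c p < 0 := by
    have h3 : ¬ 0 < C.o b c p := fun h3 => hemp p ⟨h1, h3, by rw [e]; exact h2⟩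
    have hne : C.o b c p ≠ 0 := C.o_ne_zero hbc.ne (C.ne_of_o_ne_zero h1.ne').2.2
      (C.ne_of_o_ne_zero h2.ne').2.2.symm
    exact lt_of_le_of_ne (not_lt.1 h3) hne
  refine hT a p b c hp hbc ⟨?_, ?_⟩
  · rw [C.o_swap]
    have := mul_pos h1 h2
    linarith
  · rw [C.o_rot]
    exact mul_neg_of_pos_of_neg hpos h3

lemma IsTri.third_unique {T : SimpleGraph V} (hT : C.CrossingFree T) {a b c c' : V}
    (h : C.IsTri T a b c) (h' : C.IsTri T a b c') : c = c' := by
  by_contra hne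
  have hac := h.2.2.1.ne.symm
  have hac' := h'.2.2.1.ne.symm
  rcases lt_or_gt_of_ne (C.o_ne_zero hac hac' hne) with h1 | h1
  · exact h.not_adj_in_wedge hT h'.2.2.1.symm h'.2.2.2.1 (by rw [C.o_swap]; linarith)
  · exact h'.not_adj_in_wedge hT h.2.2.1.symm h.2.2.2.1 h1

/-- Consecutive neighbours of a vertex of a triangulation that span an angle less than `π` span an
empty triangle. -/
lemma Triangulation.isTri_of_consecutive [Finite V] {T : SimpleGraph V} (hT : C.Triangulation T)
    {v w q : V} (hvw : T.Adj v w) (hvq : T.Adj v q) (hpos : 0 < C.o v w q)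
    (hnext : ∀ z, T.Adj v z → 0 < C.o v w z → ¬ 0 < C.o v z q) : C.IsTri T v w q := by
  classical
  have := Fintype.ofFinite V
  have hD := hpos.ne'
  have hD' : C.o v q w ≠ 0 := by rw [C.o_swap]; exact neg_ne_zero.2 hD
  have eα : ∀ s, C.o v s q = C.o v w q * C.coord v w q s := fun s => by
    rw [coord]; field_simp
  have eβ : ∀ s, C.o v w s = C.o v w q * C.coord v q w s := fun s => by
    rw [coord_swap]; field_simp
  have eγ : ∀ s, C.o w q s = C.o v w q * (1 - (C.coord v w q s + C.coord v q w s)) := fun s => by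
    have := C.o_eq_of_origin v w q s
    rw [C.o_swap v s q] at this
    linear_combination this - eα s - eβ s
  have posD : ∀ t, 0 < C.o v w q * t ↔ 0 < t := fun t => mul_pos_iff_of_pos_left hpos
  -- An edge that meets the triangle and has its endpoint `c` on `v`'s side of the line `wq` must
  -- have `c` inside the triangle: otherwise it crosses one of the edges `vw`, `vq`.
  have exit : ∀ c d x1 x2 t, T.Adj c d → c ≠ v → d ≠ v → 0 < t → t < 1 →
      x1 = (1 - t) * C.coord v w q c + t * C.coord v w q d →
      x2 = (1 - t) * C.coord v q w c + t * C.coord v q w d → 0 < x1 → 0 < x2 → x1 + x2 ≤ 1 →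
      C.coord v w q c + C.coord v q w c < 1 → 0 < C.coord v w q c ∧ 0 < C.coord v q w c := by
    intro c d x1 x2 t hcd hc hd ht0 ht1 hx1 hx2 h1 h2 hx hc1
    by_contra hcon
    have hcon' : C.coord v w q c ≤ 0 ∨ C.coord v q w c ≤ 0 := by
      by_contra h; push Not at h; exact hcon h
    rcases C.crosses_side_or hD hc hd hcd.ne ht0 ht1 hx1 hx2 h1 h2 hx hc1 hcon' with h | h
    · exact hT.1 _ _ _ _ hvw hcd h
    · exact hT.1 _ _ _ _ hvq hcd h
  -- Of the points inside, let `s` be the one farthest from the line `wq`. An edge crossing `vs`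
  -- would have an endpoint farther still, which by `exit` is inside the triangle. So `vs` is an
  -- edge of `T` between the consecutive edges `vw` and `vq`.
  have hemp : ∀ s, ¬ (0 < C.coord v w q s ∧ 0 < C.coord v q w s ∧
      C.coord v w q s + C.coord v q w s < 1) := by
    by_contra hex
    push Not at hex
    obtain ⟨s', hs'⟩ := hex
    obtain ⟨s, hs, hmin⟩ := (Finset.univ.filter fun s => 0 < C.coord v w q s ∧
      0 < C.coord v q w s ∧ C.coord v w q s + C.coord v q w s < 1).exists_min_image
      (fun s => C.coord v w q s + C.coord v q w s) ⟨s', by simpa using hs'⟩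
    simp only [Finset.mem_filter, Finset.mem_univ, true_and] at hs hmin
    obtain ⟨hs1, hs2, hs3⟩ := hs
    have hvs : v ≠ s := by rintro rfl; simp at hs1
    refine hnext s (hT.adj_of_not_crosses hvs ?_) (by rw [eβ, posD]; exact hs2)
      (by rw [eα, posD]; exact hs1)
    have main : ∀ c d, T.Adj c d → C.Crosses v s c d →
        ¬ C.coord v w q c + C.coord v q w c < C.coord v w q s + C.coord v q w s := by
      intro c d hcd hX hlt
      obtain ⟨σ, t, hσ0, hσ1, ht0, ht1, hx, hy⟩ := hX.exists_point
      have a1 := C.coord_combo (v := v) (w := w) (q := q) hx hy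
      have a2 := C.coord_combo (v := v) (w := q) (q := w) hx hy
      rw [C.coord_origin, mul_zero, zero_add] at a1 a2
      have p1 := mul_pos hσ0 hs1
      have p2 := mul_pos hσ0 hs2
      have p3 : σ * C.coord v w q s + σ * C.coord v q w s ≤ 1 := by
        have := mul_pos (sub_pos.2 hσ1) (add_pos hs1 hs2); linarith
      have h1 := exit c d _ _ t hcd hX.ne.2.1.symm hX.ne.2.2.1.symm ht0 ht1 a1 a2 p1 p2 p3
        (by linarith)
      have := hmin c ⟨h1.1, h1.2, by linarith⟩
      linarith
    intro c d hcd hX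
    have m1 := main c d hcd hX
    have m2 := main d c hcd.symm hX.swap_right
    obtain ⟨σ, t, hσ0, hσ1, ht0, ht1, hx, hy⟩ := hX.exists_point
    have a1 := C.coord_combo (v := v) (w := w) (q := q) hx hy
    have a2 := C.coord_combo (v := v) (w := q) (q := w) hx hy
    rw [C.coord_origin, mul_zero, zero_add] at a1 a2
    have := mul_nonneg (sub_nonneg.2 ht1.le) (sub_nonneg.2 (not_lt.1 m1))
    have := mul_nonneg ht0.le (sub_nonneg.2 (not_lt.1 m2))
    have := mul_pos (sub_pos.2 hσ1) (add_pos hs1 hs2)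
    linarith
  refine ⟨hvw, hT.adj_of_not_crosses (C.ne_of_o_ne_zero hD).2.2 ?_, hvq.symm, hpos, ?_⟩
  -- An edge crossing `wq` would have an endpoint on `v`'s side: either `v` itself, against
  -- consecutiveness, or a point inside the triangle, against `hemp`.
  · have main : ∀ c d, T.Adj c d → C.Crosses w q c d →
        ¬ C.coord v w q c + C.coord v q w c < 1 := by
      intro c d hcd hX hlt
      obtain ⟨σ, t, hσ0, hσ1, ht0, ht1, hx, hy⟩ := hX.exists_point
      have a1 := C.coord_combo (v := v) (w := w) (q := q) hx hy
      have a2 := C.coord_combo (v := v) (w := q) (q := w) hx hy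
      rw [C.coord_self hD, C.coord_outer] at a1
      rw [C.coord_self hD', C.coord_outer] at a2
      have hd : d ≠ v := by
        rintro rfl
        rw [C.coord_origin] at a1 a2
        have := mul_lt_mul_of_pos_left hlt (sub_pos.2 ht1)
        linarith
      by_cases hc : c = v
      · subst hc
        rw [C.coord_origin] at a1 a2
        refine hnext d hcd ?_ ?_
        · rw [eβ, posD]
          by_contra hn
          have := mul_nonneg ht0.le (neg_nonneg.2 (not_lt.1 hn))
          linarith
        · rw [eα, posD]
          by_contra hn
          have := mul_nonneg ht0.le (neg_nonneg.2 (not_lt.1 hn))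
          linarith
      · have h1 := exit c d _ _ t hcd hc hd ht0 ht1 a1 a2 (by linarith) (by linarith) (by linarith)
          hlt
        exact hemp c ⟨h1.1, h1.2, hlt⟩
    intro c d hcd hX
    have m1 := main c d hcd hX
    have m2 := main d c hcd.symm hX.swap_right
    obtain ⟨σ, t, hσ0, hσ1, ht0, ht1, hx, hy⟩ := hX.exists_point
    have a1 := C.coord_combo (v := v) (w := w) (q := q) hx hy
    have a2 := C.coord_combo (v := v) (w := q) (q := w) hx hy
    rw [C.coord_self hD, C.coord_outer] at a1
    rw [C.coord_self hD', C.coord_outer] at a2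
    have k1 : C.coord v w q c + C.coord v q w c ≠ 1 := by
      intro h
      have := hX.1
      rw [eγ c, h] at this
      simp at this
    have k2 : 1 < C.coord v w q c + C.coord v q w c := lt_of_le_of_ne (not_lt.1 m1) k1.symm
    have := mul_pos (sub_pos.2 ht1) (sub_pos.2 k2)
    have := mul_nonneg ht0.le (sub_nonneg.2 (not_lt.1 m2))
    linarith
  · rintro s ⟨h1, h2, h3⟩
    rw [eβ, posD] at h1
    rw [eγ, posD] at h2
    rw [← C.o_rot, ← C.o_rot, C.o_rot, eα, posD] at h3
    exact hemp s ⟨h3, h1, by linarith⟩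

lemma exists_next [Finite V] {T : SimpleGraph V} {v w z : V} (hz : T.Adj v z)
    (hpos : 0 < C.o v w z) :
    ∃ q, T.Adj v q ∧ 0 < C.o v w q ∧ ∀ z, T.Adj v z → 0 < C.o v w z → 0 ≤ C.o v q z := by
  classical
  have := Fintype.ofFinite V
  obtain ⟨q, hq, h⟩ := C.exists_first (v := v) (u := w)
    (Finset.univ.filter fun z => T.Adj v z ∧ 0 < C.o v w z) ⟨z, by simp [hz, hpos]⟩
    (fun z hz => (Finset.mem_filter.1 hz).2.2)
  simp only [Finset.mem_filter, Finset.mem_univ, true_and] at hq h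
  exact ⟨q, hq.1, hq.2, fun z h1 h2 => h z ⟨h1, h2⟩⟩

lemma Triangulation.exists_isTri [Finite V] {T : SimpleGraph V} (hT : C.Triangulation T)
    {v w z : V} (hvw : T.Adj v w) (hz : 0 < C.o v w z) : ∃ q, C.IsTri T v w q := by
  obtain ⟨z', hz', hpos⟩ := hT.exists_adj_left hz
  obtain ⟨q, hq, hqpos, hmin⟩ := exists_next hz' hpos
  refine ⟨q, hT.isTri_of_consecutive hvw hq hqpos fun y hy h1 h2 => ?_⟩
  have := hmin y hy h1
  rw [C.o_swap] at this
  linarith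

end PointConfig

open scoped Classical in
/-- The edges of a graph on a finite vertex set. -/
noncomputable def edges {V : Type*} [Fintype V] (G : SimpleGraph V) : Finset (Sym2 V) :=
  Finset.univ.filter fun e => e ∈ G.edgeSet

lemma mem_edges {V : Type*} [Fintype V] {G : SimpleGraph V} {a b : V} :
    s(a, b) ∈ edges G ↔ G.Adj a b := by
  simp [edges]

/-! ### Counting triangles and edges by the left-to-right order. -/

namespace PointConfig

variable {V : Type*} (C : PointConfig V)

/-- `v` has other points strictly to the left of each of its rays. -/
def Interior (v : V) : Prop := (∃ w, w ≠ v) ∧ ∀ w, w ≠ v → ∃ z, 0 < C.o v w z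

lemma x_identity (m a b c : V) : (C.x a - C.x m) * C.o m b c + (C.x b - C.x m) * C.o m c a +
    (C.x c - C.x m) * C.o m a b = 0 := by
  simp only [o_def, x]; ring

variable {C}

/-- Here the triangle lies above its middle vertex `m`, so its angle at `m` contains the upward
vertical direction. Two such angles overlap, and unless the triangles agree an edge of one enters
the angle of the other. -/
lemma IsTri.unique_middle_up {T : SimpleGraph V} (hT : C.CrossingFree T) {m a b a' b' : V}
    (h : C.IsTri T a m b) (h' : C.IsTri T a' m b') (ha : C.x a < C.x m) (hb : C.x m < C.x b)
    (ha' : C.x a' < C.x m) (hb' : C.x m < C.x b') : a = a' ∧ b = b' := by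
  have main : ∀ {a b a' b' : V}, C.IsTri T a m b → C.IsTri T a' m b' → C.x a < C.x m →
      C.x m < C.x b → C.x a' < C.x m → C.x m < C.x b' → ¬ 0 < C.o m b b' := by
    intro a b a' b' h h' ha hb ha' hb' hpos
    refine h.rot.not_adj_in_wedge hT h'.rot.1 hpos ?_
    have id := C.x_identity m a b b'
    have h1 : 0 < C.o m b a := h.rot.2.2.2.1
    rw [C.o_swap m b a] at id
    have := mul_pos (sub_pos.2 hb') h1
    have := mul_pos (sub_pos.2 ha) hpos
    exact pos_of_mul_pos_right (by linarith : 0 < (C.x b - C.x m) * C.o m b' a) (sub_pos.2 hb).le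
  have hbb : b = b' := by
    by_contra hne
    rcases lt_or_gt_of_ne (C.o_ne_zero h.rot.1.ne h'.rot.1.ne hne) with h1 | h1
    · exact main h' h ha' hb' ha hb (by rw [C.o_swap]; linarith)
    · exact main h h' ha hb ha' hb' h1
  subst hbb
  exact ⟨h.rot.third_unique hT h'.rot, rfl⟩


lemma CrossingFree.mirror {T : SimpleGraph V} (hT : C.CrossingFree T) :
    C.mirror.CrossingFree T := fun a b c d h1 h2 => by simpa using hT a b c d h1 h2

lemma IsTri.mirror {T : SimpleGraph V} {a b c : V} (h : C.IsTri T a b c) :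
    C.mirror.IsTri T c b a := by
  obtain ⟨h1, h2, h3, h4, h5⟩ := h
  refine ⟨h2.symm, h1.symm, h3.symm, ?_, fun s hs => h5 s ?_⟩
  · rw [mirror_o, C.o_swap_left b c a, C.o_rot]; linarith
  · simp only [mirror_o] at hs
    rw [C.o_swap_left b a s, C.o_swap_left c b s, C.o_swap_left a c s]
    exact ⟨by linarith [hs.2.1], hs.1, hs.2.2⟩

lemma IsTri.unique_middle_down {T : SimpleGraph V} (hT : C.CrossingFree T) {m a b a' b' : V}
    (h : C.IsTri T b m a) (h' : C.IsTri T b' m a') (ha : C.x a < C.x m) (hb : C.x m < C.x b)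
    (ha' : C.x a' < C.x m) (hb' : C.x m < C.x b') : a = a' ∧ b = b' :=
  h.mirror.unique_middle_up hT.mirror h'.mirror ha hb ha' hb'

/-- The upward vertical is interior to the cone of `a`, `b` at `m` and the downward one to that of
`a'`, `b'`. A closed half-plane at `m` containing all four points would have a vertical boundary,
but `a` and `b` are strictly on different sides of the vertical line. -/
lemma interior_of_middle {T : SimpleGraph V} {m a b a' b' : V}
    (h : C.IsTri T a m b) (h' : C.IsTri T b' m a') (ha : C.x a < C.x m) (hb : C.x m < C.x b)
    (ha' : C.x a' < C.x m) (hb' : C.x m < C.x b') : C.Interior m := by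
  refine ⟨⟨a, h.1.ne⟩, fun w hw => ?_⟩
  by_contra hcon
  push Not at hcon
  have h1 : 0 < C.o m b a := h.rot.2.2.2.1
  have h2 : 0 < C.o m a' b' := h'.rot.2.2.2.1
  have i1 := C.x_identity m w a b
  have i2 := C.x_identity m w a' b'
  have e1 := C.o_swap m a w
  have e2 := C.o_swap m a' w
  have e3 := C.o_swap m b a
  have e4 := C.o_swap m w b
  have e5 := C.o_swap m w b'
  have p1 := mul_nonneg (sub_nonneg.2 ha.le) (neg_nonneg.2 (hcon b))
  have p2 := mul_nonneg (sub_nonneg.2 hb.le) (neg_nonneg.2 (hcon a))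
  have p3 := mul_nonneg (sub_nonneg.2 ha'.le) (neg_nonneg.2 (hcon b'))
  have p4 := mul_nonneg (sub_nonneg.2 hb'.le) (neg_nonneg.2 (hcon a'))
  rw [e3, e4] at i1
  rw [e5] at i2
  rcases lt_or_gt_of_ne (C.x_ne hw) with hx | hx
  · have := mul_pos (sub_pos.2 hx) h2
    nlinarith
  · have := mul_pos (sub_pos.2 hx) h1
    nlinarith

open scoped Classical in
variable (C) in
/-- The points that are not interior. -/
noncomputable def hullVertices [Fintype V] : Finset V := Finset.univ.filter fun v => ¬ C.Interior v

open scoped Classical in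
variable (C) in
/-- The vertex sets of the empty triangles of `T`. -/
noncomputable def triangles [Fintype V] (T : SimpleGraph V) : Finset (Finset V) :=
  Finset.univ.filter fun t => ∃ a b c, C.IsTri T a b c ∧ t = {a, b, c}

open scoped Classical in
lemma exists_leftmost {T : SimpleGraph V} {t : Finset V}
    (h : ∃ a b c, C.IsTri T a b c ∧ t = {a, b, c}) :
    ∃ a b c, C.IsTri T a b c ∧ t = {a, b, c} ∧ C.x a < C.x b ∧ C.x a < C.x c := by
  obtain ⟨a, b, c, h, rfl⟩ := h
  have hab := C.x_ne h.1.ne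
  have hbc := C.x_ne h.2.1.ne
  have hca := C.x_ne h.2.2.1.ne
  have e1 : ({a, b, c} : Finset V) = {b, c, a} := by ext; simp; tauto
  have e2 : ({a, b, c} : Finset V) = {c, a, b} := by ext; simp; tauto
  rcases lt_or_gt_of_ne hab with h1 | h1
  · rcases lt_or_gt_of_ne hca with h2 | h2
    · exact ⟨c, a, b, h.rot.rot, e2, h2, h2.trans h1⟩
    · exact ⟨a, b, c, h, rfl, h1, h2⟩
  · rcases lt_or_gt_of_ne hbc with h2 | h2
    · exact ⟨b, c, a, h.rot, e1, h2, h1⟩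
    · exact ⟨c, a, b, h.rot.rot, e2, h2.trans h1, h2⟩

/-- Every point is the middle vertex of at most one triangle above and one below, and a hull vertex
is not both. -/
lemma card_triangles_add_le [Fintype V] {T : SimpleGraph V} (hT : C.CrossingFree T) :
    (C.triangles T).card + C.hullVertices.card ≤ 2 * Fintype.card V := by
  classical
  let R : Finset V → V → Prop := fun t m => ∃ a b, C.IsTri T a m b ∧ t = {a, m, b} ∧
    C.x a < C.x m ∧ C.x m < C.x b
  let R' : Finset V → V → Prop := fun t m => ∃ a b, C.IsTri T b m a ∧ t = {b, m, a} ∧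
    C.x a < C.x m ∧ C.x m < C.x b
  let up : Finset V := Finset.univ.filter fun m => ∃ t, R t m
  let dn : Finset V := Finset.univ.filter fun m => ∃ t, R' t m
  let tup := (C.triangles T).filter fun t => ∃ m, R t m
  let tdn := (C.triangles T).filter fun t => ∃ m, R' t m
  have hup : tup.card ≤ up.card := by
    refine Finset.card_le_card_of_forall_subsingleton R ?_ ?_
    · intro t ht
      obtain ⟨m, hm⟩ := (Finset.mem_filter.1 ht).2
      exact ⟨m, by simpa [up] using ⟨t, hm⟩, hm⟩
    · rintro m - t ⟨-, a, b, h, rfl, h1, h2⟩ t' ⟨-, a', b', h', rfl, h1', h2'⟩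
      obtain ⟨rfl, rfl⟩ := h.unique_middle_up hT h' h1 h2 h1' h2'
      rfl
  have hdn : tdn.card ≤ dn.card := by
    refine Finset.card_le_card_of_forall_subsingleton R' ?_ ?_
    · intro t ht
      obtain ⟨m, hm⟩ := (Finset.mem_filter.1 ht).2
      exact ⟨m, by simpa [dn] using ⟨t, hm⟩, hm⟩
    · rintro m - t ⟨-, a, b, h, rfl, h1, h2⟩ t' ⟨-, a', b', h', rfl, h1', h2'⟩
      obtain ⟨rfl, rfl⟩ := h.unique_middle_down hT h' h1 h2 h1' h2'
      rfl
  have hcover : C.triangles T ⊆ tup ∪ tdn := by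
    intro t ht
    obtain ⟨a, b, c, h, rfl, h1, h2⟩ := exists_leftmost (Finset.mem_filter.1 ht).2
    rw [Finset.mem_union]
    rcases lt_or_gt_of_ne (C.x_ne h.2.1.ne) with h3 | h3
    · exact Or.inl (Finset.mem_filter.2 ⟨ht, b, a, c, h, rfl, h1, h3⟩)
    · refine Or.inr (Finset.mem_filter.2 ⟨ht, c, a, b, h.rot, ?_, h2, h3⟩)
      ext; simp; tauto
  have hint : up ∩ dn ∩ C.hullVertices = ∅ := by
    rw [Finset.eq_empty_iff_forall_notMem]
    intro m hm
    simp only [Finset.mem_inter, up, dn, hullVertices, Finset.mem_filter, Finset.mem_univ,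
      true_and] at hm
    obtain ⟨⟨⟨-, a, b, h, -, h1, h2⟩, ⟨-, a', b', h', -, h1', h2'⟩⟩, hn⟩ := hm
    exact hn (interior_of_middle h h' h1 h2 h1' h2')
  -- The number of triangles is at most `|up| + |dn| = |up ∪ dn| + |up ∩ dn| ≤ N + (N - h)`.
  have c1 := Finset.card_le_card hcover
  have c2 := Finset.card_union_le tup tdn
  have c3 := Finset.card_union_add_card_inter up dn
  have c4 := Finset.card_le_univ (up ∪ dn)
  have c5 := Finset.card_union_of_disjoint (Finset.disjoint_iff_inter_eq_empty.2 hint)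
  have c6 := Finset.card_le_univ (up ∩ dn ∪ C.hullVertices)
  omega

open scoped Classical in
lemma IsTri.eq_of_insert_eq {T : SimpleGraph V} {a b c b' c' : V} (h : C.IsTri T a b c)
    (h' : C.IsTri T a b' c') (he : ({a, b, c} : Finset V) = {a, b', c'}) : b = b' ∧ c = c' := by
  have mb : b ∈ ({a, b', c'} : Finset V) := by rw [← he]; simp
  have mc : c ∈ ({a, b', c'} : Finset V) := by rw [← he]; simp
  simp only [Finset.mem_insert, Finset.mem_singleton] at mb mc
  have hb : b ≠ a := h.1.ne.symm
  have hc : c ≠ a := h.2.2.1.ne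
  have hbc : b ≠ c := h.2.1.ne
  rcases mb with hb' | rfl | rfl
  · exact absurd hb' hb
  · rcases mc with hc' | hc' | rfl
    · exact absurd hc' hc
    · exact absurd hc'.symm hbc
    · exact ⟨rfl, rfl⟩
  · rcases mc with hc' | rfl | hc'
    · exact absurd hc' hc
    · have h3 := h.2.2.2.1
      have h4 := h'.2.2.2.1
      rw [C.o_swap] at h4
      linarith
    · exact absurd hc'.symm hbc

open scoped Classical in
lemma IsTri.eq_of_leftmost {T : SimpleGraph V} {a b c a' b' c' : V} (h : C.IsTri T a b c)
    (h' : C.IsTri T a' b' c') (he : ({a, b, c} : Finset V) = {a', b', c'}) (h1 : C.x a < C.x b)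
    (h2 : C.x a < C.x c) (h1' : C.x a' < C.x b') (h2' : C.x a' < C.x c') :
    a = a' ∧ b = b' ∧ c = c' := by
  have ma : a ∈ ({a', b', c'} : Finset V) := by rw [← he]; simp
  have ma' : a' ∈ ({a, b, c} : Finset V) := by rw [he]; simp
  simp only [Finset.mem_insert, Finset.mem_singleton] at ma ma'
  have haa : a = a' := by
    rcases ma with rfl | rfl | rfl
    · rfl
    · rcases ma' with rfl | rfl | rfl <;> linarith
    · rcases ma' with rfl | rfl | rfl <;> linarith
  subst haa
  exact ⟨rfl, h.eq_of_insert_eq h' he⟩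

open scoped Classical in
lemma IsTri.rotation_of_eq {T : SimpleGraph V} {a b c a' b' c' : V} (h : C.IsTri T a b c)
    (h' : C.IsTri T a' b' c') (he : ({a, b, c} : Finset V) = {a', b', c'}) :
    (a' = a ∧ b' = b) ∨ (a' = b ∧ b' = c) ∨ (a' = c ∧ b' = a) := by
  have ma' : a' ∈ ({a, b, c} : Finset V) := by rw [he]; simp
  simp only [Finset.mem_insert, Finset.mem_singleton] at ma'
  rcases ma' with rfl | rfl | rfl
  · exact Or.inl ⟨rfl, (h.eq_of_insert_eq h' he).1.symm⟩
  · refine Or.inr (Or.inl ⟨rfl, (h.rot.eq_of_insert_eq h' ?_).1.symm⟩)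
    rw [← he]; ext; simp; tauto
  · refine Or.inr (Or.inr ⟨rfl, (h.rot.rot.eq_of_insert_eq h' ?_).1.symm⟩)
    rw [← he]; ext; simp; tauto

/-- Look at each edge from its left endpoint `v`. If another rightward edge at `v` follows it
counterclockwise, charge it to the triangle on its left, whose leftmost vertex is `v`. The last
rightward edge at `v` is charged to `v`. -/
lemma Triangulation.card_edges_le [Fintype V] {T : SimpleGraph V} (hT : C.Triangulation T) :
    (edges T).card ≤ Fintype.card V + (C.triangles T).card := by
  classical
  let R : Sym2 V → V ⊕ Finset V → Prop := fun e => Sum.elim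
    (fun v => ∃ w, e = s(v, w) ∧ T.Adj v w ∧ C.x v < C.x w ∧
      ∀ z, T.Adj v z → C.x v < C.x z → ¬ 0 < C.o v w z)
    (fun t => ∃ v w q, e = s(v, w) ∧ C.IsTri T v w q ∧ t = {v, w, q} ∧
      C.x v < C.x w ∧ C.x v < C.x q)
  have key := Finset.card_le_card_of_forall_subsingleton R (s := edges T)
    (t := Finset.univ.disjSum (C.triangles T)) ?_ ?_
  · rwa [Finset.card_disjSum, Finset.card_univ] at key
  · have main : ∀ v w, T.Adj v w → C.x v < C.x w →
        ∃ b ∈ Finset.univ.disjSum (C.triangles T), R s(v, w) b := by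
      intro v w hvw hx
      by_cases h : ∃ z, T.Adj v z ∧ C.x v < C.x z ∧ 0 < C.o v w z
      · obtain ⟨z, hz, hxz, hpos⟩ := h
        obtain ⟨q, hq, hqpos, hmin⟩ := exists_next hz hpos
        have hqz := hmin z hz hpos
        have htri : C.IsTri T v w q := by
          refine hT.isTri_of_consecutive hvw hq hqpos fun y hy h1 h2 => ?_
          have := hmin y hy h1
          rw [C.o_swap] at this
          linarith
        have hxq : C.x v < C.x q := by
          have id := C.x_identity v w q z
          rw [C.o_swap v w z] at id
          have p1 := mul_nonneg (sub_nonneg.2 hx.le) hqz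
          have p2 := mul_pos (sub_pos.2 hxz) hqpos
          have : 0 < (C.x q - C.x v) * C.o v w z := by linarith
          exact sub_pos.1 (pos_of_mul_pos_left this hpos.le)
        refine ⟨Sum.inr {v, w, q}, ?_, v, w, q, rfl, htri, rfl, hx, hxq⟩
        simp only [Finset.inr_mem_disjSum, triangles, Finset.mem_filter, Finset.mem_univ, true_and]
        exact ⟨v, w, q, htri, rfl⟩
      · push Not at h
        exact ⟨Sum.inl v, by simp, w, rfl, hvw, hx, fun z h1 h2 => not_lt.2 (h z h1 h2)⟩
    intro e he
    induction e using Sym2.ind with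
    | _ v w =>
      rw [mem_edges] at he
      rcases lt_or_gt_of_ne (C.x_ne he.ne) with hx | hx
      · exact main v w he hx
      · rw [Sym2.eq_swap]; exact main w v he.symm hx
  · rintro (v | t) -
    · rintro e ⟨-, w, rfl, h1, h2, h3⟩ e' ⟨-, w', rfl, h1', h2', h3'⟩
      rw [C.eq_of_o_nonpos h1.ne h1'.ne (not_lt.1 (h3 _ h1' h2')) (not_lt.1 (h3' _ h1 h2))]
    · rintro e ⟨-, v, w, q, rfl, h, rfl, h1, h2⟩ e' ⟨-, v', w', q', rfl, h', he, h1', h2'⟩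
      obtain ⟨rfl, rfl, -⟩ := h.eq_of_leftmost h' he h1 h2 h1' h2'
      rfl

end PointConfig

/-! ### Sparse convex-faced subgraphs. -/

namespace PointConfig

variable {V : Type*} (C : PointConfig V)

/-- The graph contains all hull edges, and each interior point lies in the interior of the convex
hull of its neighbours; the bounded faces are then convex. -/
def ConvexFaces (Q : SimpleGraph V) : Prop :=
  (∀ v w, v ≠ w → (∀ s, 0 ≤ C.o v w s) → Q.Adj v w) ∧
    ∀ v, C.Interior v → ∀ u, u ≠ v → ∃ z, Q.Adj v z ∧ 0 < C.o v u z

/-- The edge `vu` precedes `vw` in the counterclockwise order around `v`, and the removal of `vw`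
leaves an angle of at least `π` after `vu`. -/
def Pred (P : SimpleGraph V) (v u w : V) : Prop :=
  P.Adj v u ∧ P.Adj v w ∧ 0 < C.o v u w ∧ ∀ z, P.Adj v z → z ≠ w → C.o v u z ≤ 0

/-- The edge `vw` cannot be removed because of the angles at `v`. -/
def Essential (P : SimpleGraph V) (v w : V) : Prop := C.Interior v ∧ ∃ u, C.Pred P v u w

/-- Every essential edge is owned by one endpoint at which it is essential. -/
def Owns (P : SimpleGraph V) (v w : V) : Prop :=
  C.Essential P v w ∧ (¬ C.Essential P w v ∨ C.x v < C.x w)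

variable {C}

lemma ConvexFaces.mono {P Q : SimpleGraph V} (h : C.ConvexFaces P) (hPQ : P ≤ Q) :
    C.ConvexFaces Q :=
  ⟨fun v w h1 h2 => hPQ (h.1 v w h1 h2), fun v hv u hu =>
    let ⟨z, hz, hz'⟩ := h.2 v hv u hu
    ⟨z, hPQ hz, hz'⟩⟩

lemma Triangulation.convexFaces [Finite V] {T : SimpleGraph V} (hT : C.Triangulation T) :
    C.ConvexFaces T := by
  refine ⟨fun v w hvw h => hT.adj_of_not_crosses hvw fun c d _ hX => ?_, fun v hv u hu => ?_⟩
  · have := mul_nonneg (h c) (h d)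
    linarith [hX.1]
  · obtain ⟨z, hz⟩ := hv.2 u hu
    exact hT.exists_adj_left hz

lemma Pred.unique {P : SimpleGraph V} {v u u' w : V} (h : C.Pred P v u w)
    (h' : C.Pred P v u' w) : u = u' := by
  obtain ⟨h1, h2, h3, h4⟩ := h
  obtain ⟨h1', h2', h3', h4'⟩ := h'
  exact C.eq_of_o_nonpos h1.ne h1'.ne (h4 _ h1' (C.ne_of_o_ne_zero h3'.ne').2.2)
    (h4' _ h1 (C.ne_of_o_ne_zero h3.ne').2.2)

lemma Pred.succ_unique {P : SimpleGraph V} {v u w w' : V} (h : C.Pred P v u w)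
    (h' : C.Pred P v u w') : w = w' := by
  by_contra hne
  have := h.2.2.2 w' h'.2.1 (Ne.symm hne)
  linarith [h'.2.2.1]

/-- Two essential edges at a vertex are consecutive. -/
lemma Pred.consecutive {P : SimpleGraph V} {v u u' w w' : V} (h : C.Pred P v u w)
    (h' : C.Pred P v u' w') (hne : w ≠ w') : u = w' ∨ u' = w := by
  by_contra hcon
  push Not at hcon
  have : u = u' := C.eq_of_o_nonpos h.1.ne h'.1.ne (h.2.2.2 _ h'.1 hcon.2) (h'.2.2.2 _ h.1 hcon.1)
  subst this
  exact hne (h.succ_unique h')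

lemma Owns.asymm {P : SimpleGraph V} {v w : V} (h : C.Owns P v w) : ¬ C.Owns P w v := by
  rintro ⟨h1, h2⟩
  obtain ⟨h3, h4⟩ := h
  rcases h2 with h2 | h2
  · exact h2 h3
  · rcases h4 with h4 | h4
    · exact h4 h1
    · exact lt_asymm h2 h4

lemma Essential.owns_or {P : SimpleGraph V} {v w : V} (h : C.Essential P v w) :
    C.Owns P v w ∨ C.Owns P w v := by
  by_cases h' : C.Essential P w v
  · have hne : v ≠ w := by obtain ⟨-, u, hu⟩ := h; exact hu.2.1.ne
    rcases lt_or_gt_of_ne (C.x_ne hne) with hx | hx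
    · exact Or.inl ⟨h, Or.inr hx⟩
    · exact Or.inr ⟨h', Or.inr hx⟩
  · exact Or.inl ⟨h, Or.inl h'⟩

/-- The direction `u` witnessing that `vw` is needed may not be a neighbour. Turn clockwise from
`vu` to the nearest neighbour `a` other than `w`; some neighbour is strictly left of `va`, and it
can only be `w`. -/
lemma ConvexFaces.exists_pred [Finite V] {P : SimpleGraph V} (hP : C.ConvexFaces P) {v u w : V}
    (hv : C.Interior v) (hu : u ≠ v) (hvw : P.Adj v w) (huw : 0 < C.o v u w)
    (h : ∀ z, P.Adj v z → z ≠ w → C.o v u z ≤ 0) : ∃ u, C.Pred P v u w := by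
  classical
  have := Fintype.ofFinite V
  by_cases hvu : P.Adj v u
  · exact ⟨u, hvu, hvw, huw, h⟩
  · obtain ⟨z, hz, hpos⟩ := hP.2 v hv w hvw.ne.symm
    obtain ⟨a, ha, hmax⟩ := C.exists_last (v := v) (u := u)
      (Finset.univ.filter fun z => P.Adj v z ∧ z ≠ w)
      ⟨z, by simpa using ⟨hz, (C.ne_of_o_ne_zero hpos.ne').2.2.symm⟩⟩ (fun z hz => by
        simp only [Finset.mem_filter, Finset.mem_univ, true_and] at hz
        refine lt_of_le_of_ne (h z hz.1 hz.2) (C.o_ne_zero hu.symm hz.1.ne ?_)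
        rintro rfl
        exact hvu hz.1)
    simp only [Finset.mem_filter, Finset.mem_univ, true_and] at ha hmax
    obtain ⟨b, hb, hbpos⟩ := hP.2 v hv a ha.1.ne.symm
    have hbw : b = w := by
      by_contra hne
      linarith [hmax b ⟨hb, hne⟩]
    subst hbw
    exact ⟨a, ha.1, hvw, hbpos, fun z h1 h2 => hmax z ⟨h1, h2⟩⟩

/-- Deleting `vw` must violate convexity. As `vw` is no hull edge, the violation is an angle at an
interior point which has lost a neighbour, that is, at `v` or `w`. -/
lemma essential_of_minimal [Finite V] {T P : SimpleGraph V}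
    (hP : Minimal (fun Q => Q ≤ T ∧ C.ConvexFaces Q) P) {v w : V} (hvw : P.Adj v w)
    (h1 : ¬ ∀ s, 0 ≤ C.o v w s) (h2 : ¬ ∀ s, 0 ≤ C.o w v s) :
    C.Essential P v w ∨ C.Essential P w v := by
  have hdel : ∀ a b, (P.deleteEdges {s(v, w)}).Adj a b ↔ P.Adj a b ∧ s(a, b) ≠ s(v, w) := by
    intro a b; simp [SimpleGraph.deleteEdges_adj]
  have hnot : ¬ C.ConvexFaces (P.deleteEdges {s(v, w)}) := by
    intro hC
    have := hP.2 ⟨(SimpleGraph.deleteEdges_le _).trans hP.1.1, hC⟩ (SimpleGraph.deleteEdges_le _)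
    exact ((hdel v w).1 (this hvw)).2 rfl
  have hC := hP.1.2
  simp only [ConvexFaces, not_and] at hnot
  have hnot' := hnot fun a b hab hs => by
    rw [hdel]
    refine ⟨hC.1 a b hab hs, fun he => ?_⟩
    rw [Sym2.eq_iff] at he
    rcases he with ⟨rfl, rfl⟩ | ⟨rfl, rfl⟩
    · exact h1 hs
    · exact h2 hs
  push Not at hnot'
  obtain ⟨a, ha, u, hu, hz⟩ := hnot'
  obtain ⟨z, haz, hpos⟩ := hC.2 a ha u hu
  have he : s(a, z) = s(v, w) := by
    by_contra hne
    linarith [hz z ((hdel a z).2 ⟨haz, hne⟩)]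
  have hE : C.Essential P a z := by
    refine ⟨ha, hC.exists_pred ha hu haz hpos fun y hy hyz => hz y ((hdel a y).2 ⟨hy, fun h => ?_⟩)⟩
    rw [← he] at h
    exact hyz (Sym2.congr_right.1 h)
  rw [Sym2.eq_iff] at he
  rcases he with ⟨rfl, rfl⟩ | ⟨rfl, rfl⟩
  · exact Or.inl hE
  · exact Or.inr hE

lemma mem_hullVertices_of_right [Fintype V] {v w : V} (hne : v ≠ w) (h : ∀ s, C.o v w s ≤ 0) :
    v ∈ C.hullVertices := by
  simp only [hullVertices, Finset.mem_filter, Finset.mem_univ, true_and]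
  intro hv
  obtain ⟨z, hz⟩ := hv.2 w hne.symm
  linarith [h z]

open scoped Classical in
variable (C) in
/-- The directed edges owned by their first endpoint. -/
noncomputable def owned [Fintype V] (P : SimpleGraph V) : Finset (V × V) :=
  Finset.univ.filter fun e => C.Owns P e.1 e.2

open scoped Classical in
variable (C) in
/-- The owned directed edges whose predecessor has the same owner. -/
noncomputable def good [Fintype V] (P : SimpleGraph V) : Finset (V × V) :=
  Finset.univ.filter fun e => C.Owns P e.1 e.2 ∧ ∃ u, C.Pred P e.1 u e.2 ∧ C.Owns P e.1 u

/-- A hull edge is charged to the endpoint from which all points lie to its right; every other edge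
is essential and charged to its ownership. -/
lemma card_edges_le_of_minimal [Fintype V] {T P : SimpleGraph V}
    (hP : Minimal (fun Q => Q ≤ T ∧ C.ConvexFaces Q) P) :
    (edges P).card ≤ C.hullVertices.card + (C.owned P).card := by
  classical
  let R : Sym2 V → V ⊕ (V × V) → Prop := fun e => Sum.elim
    (fun v => ∃ w, e = s(v, w) ∧ v ≠ w ∧ ∀ s, C.o v w s ≤ 0) (fun p => e = s(p.1, p.2))
  have key := Finset.card_le_card_of_forall_subsingleton R (s := edges P)
    (t := C.hullVertices.disjSum (C.owned P)) ?_ ?_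
  · rwa [Finset.card_disjSum] at key
  · intro e he
    induction e using Sym2.ind with
    | _ v w =>
      rw [mem_edges] at he
      by_cases h1 : ∀ s, 0 ≤ C.o v w s
      · have h : ∀ s, C.o w v s ≤ 0 := fun s => by rw [C.o_swap_left]; linarith [h1 s]
        exact ⟨Sum.inl w, by simpa using mem_hullVertices_of_right he.ne.symm h, v, Sym2.eq_swap,
          he.ne.symm, h⟩
      by_cases h2 : ∀ s, 0 ≤ C.o w v s
      · have h : ∀ s, C.o v w s ≤ 0 := fun s => by rw [C.o_swap_left]; linarith [h2 s]
        exact ⟨Sum.inl v, by simpa using mem_hullVertices_of_right he.ne h, w, rfl, he.ne, h⟩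
      have ho : C.Owns P v w ∨ C.Owns P w v := by
        rcases essential_of_minimal hP he h1 h2 with h | h
        · exact h.owns_or
        · exact h.owns_or.symm
      rcases ho with h | h
      · exact ⟨Sum.inr (v, w), by simpa [owned] using h, rfl⟩
      · exact ⟨Sum.inr (w, v), by simpa [owned] using h, Sym2.eq_swap⟩
  · rintro (v | p) -
    · rintro e ⟨-, w, rfl, hw, h⟩ e' ⟨-, w', rfl, hw', h'⟩
      rw [C.eq_of_o_nonpos hw hw' (h w') (h' w)]
    · rintro e ⟨-, he⟩ e' ⟨-, he'⟩
      exact he.trans he'.symm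

/-- Send a good edge `vw` with predecessor `vu` to the triangle of `T` on the left of `vu`. If a
good edge at `u` led to the same triangle, it would have to be `uv`, since its removal opens an
angle containing `v`; but `uv` is owned by `v`. -/
lemma card_good_le [Fintype V] {T P : SimpleGraph V} (hT : C.Triangulation T) (hPT : P ≤ T) :
    (C.good P).card ≤ (C.triangles T).card := by
  classical
  refine Finset.card_le_card_of_forall_subsingleton
    (fun e t => ∃ u q, C.Pred P e.1 u e.2 ∧ C.Owns P e.1 u ∧ C.IsTri T e.1 u q ∧ t = {e.1, u, q})
    ?_ ?_
  · rintro ⟨v, w⟩ he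
    obtain ⟨-, u, hu, ho⟩ := (Finset.mem_filter.1 he).2
    obtain ⟨q, hq⟩ := hT.exists_isTri (hPT hu.1) hu.2.2.1
    exact ⟨{v, u, q}, Finset.mem_filter.2 ⟨Finset.mem_univ _, v, u, q, hq, rfl⟩,
      u, q, hu, ho, hq, rfl⟩
  · have main : ∀ v u q w w', C.Pred P v u w → C.Owns P v u → C.IsTri T v u q →
        C.Pred P u q w' → ¬ C.Owns P u w' := by
      intro v u q w w' h1 h2 h3 h4 h5
      have hw : v = w' := by
        by_contra hne
        have := h4.2.2.2 v h1.1.symm hne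
        have := h3.rot.2.2.2.1
        linarith
      subst hw
      exact h2.asymm h5
    rintro t - ⟨v, w⟩ ⟨he, u, q, h1, h2, h3, rfl⟩ ⟨v', w'⟩ ⟨he', u', q', h1', h2', h3', heq⟩
    have ho := (Finset.mem_filter.1 he).2.1
    have ho' := (Finset.mem_filter.1 he').2.1
    simp only at h1 h2 h3 h1' h2' h3' heq ho ho'
    rcases h3.rotation_of_eq h3' heq with ⟨rfl, rfl⟩ | ⟨rfl, rfl⟩ | ⟨rfl, rfl⟩
    · rw [h1.succ_unique h1']
    · exact absurd ho' (main _ _ _ _ _ h1 h2 h3 h1')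
    · rcases h3'.rotation_of_eq h3 heq.symm with ⟨-, h⟩ | ⟨-, h⟩ | ⟨h, -⟩
      · exact absurd h h3.1.ne.symm
      · subst h
        exact absurd ho (main _ _ _ _ _ h1' h2' h3' h1)
      · exact absurd h h3'.2.1.ne

/-- Only interior points own edges. If such a point owns `k` edges, `g` of them good, then any two
owned edges are consecutive, so `k.choose 2 ≤ g ≤ k`. This forces `k ≤ 3` and `2 * k ≤ 3 + g`. -/
lemma card_owned_le [Fintype V] (P : SimpleGraph V) :
    (C.owned P).card + 3 * C.hullVertices.card ≤ 3 * Fintype.card V ∧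
      2 * (C.owned P).card + 3 * C.hullVertices.card ≤ 3 * Fintype.card V + (C.good P).card := by
  classical
  let k : V → Finset V := fun v => Finset.univ.filter fun w => C.Owns P v w
  let g : V → Finset V := fun v => Finset.univ.filter fun w =>
    C.Owns P v w ∧ ∃ u, C.Pred P v u w ∧ C.Owns P v u
  have hk : (C.owned P).card = ∑ v, (k v).card := by
    rw [Finset.card_eq_sum_card_fiberwise (f := Prod.fst) (t := Finset.univ) (by simp)]
    refine Finset.sum_congr rfl fun v _ => ?_
    refine Finset.card_bij' (fun e _ => e.2) (fun w _ => (v, w)) ?_ ?_ ?_ ?_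
    · rintro ⟨a, b⟩ h
      simp only [owned, Finset.mem_filter, Finset.mem_univ, true_and] at h
      obtain ⟨h, rfl⟩ := h
      simpa [k] using h
    · intro w hw
      simpa [owned, k] using hw
    · rintro ⟨a, b⟩ h
      simp only [Finset.mem_filter] at h
      simp [h.2]
    · intros; rfl
  have hg : (C.good P).card = ∑ v, (g v).card := by
    rw [Finset.card_eq_sum_card_fiberwise (f := Prod.fst) (t := Finset.univ) (by simp)]
    refine Finset.sum_congr rfl fun v _ => ?_
    refine Finset.card_bij' (fun e _ => e.2) (fun w _ => (v, w)) ?_ ?_ ?_ ?_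
    · rintro ⟨a, b⟩ h
      simp only [good, Finset.mem_filter, Finset.mem_univ, true_and] at h
      obtain ⟨h, rfl⟩ := h
      simpa [g] using h
    · intro w hw
      simpa [good, g] using hw
    · rintro ⟨a, b⟩ h
      simp only [Finset.mem_filter] at h
      simp [h.2]
    · intros; rfl
  have hchoose : ∀ v, (k v).card.choose 2 ≤ (g v).card := by
    intro v
    rw [← Finset.card_powersetCard]
    -- A pair of owned edges is sent to the one that has the other as predecessor.
    refine Finset.card_le_card_of_forall_subsingleton
      (fun s w => ∃ u, C.Pred P v u w ∧ s = {u, w}) ?_ ?_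
    · intro s hs
      rw [Finset.mem_powersetCard] at hs
      obtain ⟨w, w', hne, rfl⟩ := Finset.card_eq_two.1 hs.2
      have hw : C.Owns P v w := by simpa [k] using hs.1 (Finset.mem_insert_self _ _)
      have hw' : C.Owns P v w' := by
        simpa [k] using hs.1 (Finset.mem_insert_of_mem (Finset.mem_singleton_self _))
      obtain ⟨⟨-, u, hu⟩, -⟩ := id hw
      obtain ⟨⟨-, u', hu'⟩, -⟩ := id hw'
      rcases hu.consecutive hu' hne with rfl | rfl
      · exact ⟨w, by simpa [g] using ⟨hw, u, hu, hw'⟩, u, hu, Finset.pair_comm _ _⟩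
      · exact ⟨w', by simpa [g] using ⟨hw', u', hu', hw⟩, u', hu', rfl⟩
    · rintro w - s ⟨-, u, hu, rfl⟩ s' ⟨-, u', hu', rfl⟩
      rw [hu.unique hu']
  have hgk : ∀ v, (g v).card ≤ (k v).card := fun v => Finset.card_le_card fun w hw => by
    simp only [g, k, Finset.mem_filter, Finset.mem_univ, true_and] at hw ⊢
    exact hw.1
  have hsmall : ∀ v, (k v).card ≤ 3 ∧ 2 * (k v).card ≤ 3 + (g v).card := by
    intro v
    have h1 := hchoose v
    have h2 := hgk v
    generalize (k v).card = a at *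
    generalize (g v).card = b at *
    have ha : a ≤ 3 := by
      by_contra hcon
      obtain ⟨m, rfl⟩ : ∃ m, a = m + 4 := ⟨a - 4, by omega⟩
      have : (m + 4).choose 2 = (m + 3).choose 1 + (m + 3).choose 2 := Nat.choose_succ_succ _ _
      have e2 : (m + 3).choose 2 = (m + 2).choose 1 + (m + 2).choose 2 := Nat.choose_succ_succ _ _
      simp only [Nat.choose_one_right] at this e2
      omega
    interval_cases a <;> simp [Nat.choose] at h1 ⊢ <;> omega
  have hzero : ∀ v ∈ C.hullVertices, (k v).card = 0 := by
    intro v hv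
    rw [Finset.card_eq_zero, Finset.filter_eq_empty_iff]
    intro w _ hw
    exact (Finset.mem_filter.1 hv).2 hw.1.1
  have hcard : (C.hullVerticesᶜ).card + C.hullVertices.card = Fintype.card V :=
    Finset.card_compl_add_card _
  have s1 : ∑ v, (k v).card = ∑ v ∈ C.hullVerticesᶜ, (k v).card := by
    rw [← Finset.sum_add_sum_compl C.hullVertices, Finset.sum_eq_zero hzero, zero_add]
  have s2 : ∑ v ∈ C.hullVerticesᶜ, (k v).card ≤ ∑ v ∈ C.hullVerticesᶜ, 3 :=
    Finset.sum_le_sum fun v _ => (hsmall v).1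
  have s3 : ∑ v ∈ C.hullVerticesᶜ, 2 * (k v).card ≤ ∑ v ∈ C.hullVerticesᶜ, (3 + (g v).card) :=
    Finset.sum_le_sum fun v _ => (hsmall v).2
  have s4 : ∑ v ∈ C.hullVerticesᶜ, (g v).card ≤ ∑ v, (g v).card :=
    Finset.sum_le_sum_of_subset (Finset.subset_univ _)
  rw [← Finset.mul_sum, Finset.sum_add_distrib] at s3
  simp only [Finset.sum_const, smul_eq_mul] at s2 s3
  omega

/-- Every triangulation contains a sparse subgraph with convex faces. -/
lemma Triangulation.exists_sparse_convexFaces [Fintype V] {T : SimpleGraph V}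
    (hT : C.Triangulation T) : ∃ P ≤ T, C.ConvexFaces P ∧
      (edges P).card + 2 * C.hullVertices.card ≤ 3 * Fintype.card V ∧
      2 * (edges P).card + 2 * C.hullVertices.card ≤ 5 * Fintype.card V := by
  classical
  obtain ⟨P, -, hP⟩ := exists_minimal_le_of_wellFoundedLT
    (fun Q => Q ≤ T ∧ C.ConvexFaces Q) T ⟨le_rfl, hT.convexFaces⟩
  have h1 := card_edges_le_of_minimal hP
  have h2 := C.card_owned_le P
  have h3 := card_good_le hT hP.1.1
  have h4 := card_triangles_add_le hT.1
  -- With `o` owned edges, `|P| ≤ h + o`, where `o ≤ 3(N - h)` and `2o ≤ 3(N - h) + (2N - h)`.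
  refine ⟨P, hP.1.1, hP.1.2, ?_, ?_⟩ <;> omega

lemma Triangulation.card_edges_add_le [Fintype V] {T : SimpleGraph V}
    (hT : C.Triangulation T) : (edges T).card + C.hullVertices.card ≤ 3 * Fintype.card V := by
  have h1 := hT.card_edges_le
  have h4 := card_triangles_add_le hT.1
  omega

end PointConfig

/-! ### Flips, and many triangulations containing a convex-faced graph. -/

namespace PointConfig

variable {V : Type*} {C : PointConfig V}

/-- No edge meets the interior of an empty triangle. -/
lemma IsTri.no_edge_through {T : SimpleGraph V} (hT : C.CrossingFree T) {v w q c d : V}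
    (h : C.IsTri T v w q) (hcd : T.Adj c d) {t x1 x2 : ℝ} (ht0 : 0 < t) (ht1 : t < 1)
    (hx1 : x1 = (1 - t) * C.coord v w q c + t * C.coord v w q d)
    (hx2 : x2 = (1 - t) * C.coord v q w c + t * C.coord v q w d)
    (h1 : 0 < x1) (h2 : 0 < x2) (h12 : x1 + x2 < 1) : False := by
  have hpos := h.2.2.2.1
  have hD := hpos.ne'
  have eα : ∀ s, C.o v s q = C.o v w q * C.coord v w q s := fun s => by
    rw [coord]; field_simp
  have eβ : ∀ s, C.o v w s = C.o v w q * C.coord v q w s := fun s => by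
    rw [coord_swap]; field_simp
  have eγ : ∀ s, C.o w q s = C.o v w q * (1 - (C.coord v w q s + C.coord v q w s)) := fun s => by
    have := C.o_eq_of_origin v w q s
    rw [C.o_swap v s q] at this
    linear_combination this - eα s - eβ s
  have posD : ∀ t, 0 < C.o v w q * t ↔ 0 < t := fun t => mul_pos_iff_of_pos_left hpos
  have hwedge : ∀ p, T.Adj v p → ¬ (0 < C.coord v w q p ∧ 0 < C.coord v q w p) := by
    rintro p hp ⟨k1, k2⟩
    exact h.not_adj_in_wedge hT hp (by rw [eβ, posD]; exact k2) (by rw [eα, posD]; exact k1)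
  have main : ∀ c d t, T.Adj c d → 0 < t → t < 1 →
      x1 = (1 - t) * C.coord v w q c + t * C.coord v w q d →
      x2 = (1 - t) * C.coord v q w c + t * C.coord v q w d →
      ¬ C.coord v w q c + C.coord v q w c < 1 := by
    intro c d t hcd ht0 ht1 hx1 hx2 hc1
    by_cases hc : c = v
    · subst hc
      rw [C.coord_origin, mul_zero, zero_add] at hx1 hx2
      rw [hx1] at h1
      rw [hx2] at h2
      exact hwedge d hcd ⟨pos_of_mul_pos_right h1 ht0.le, pos_of_mul_pos_right h2 ht0.le⟩
    by_cases hd : d = v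
    · subst hd
      rw [C.coord_origin, mul_zero, add_zero] at hx1 hx2
      rw [hx1] at h1
      rw [hx2] at h2
      have ht : 0 ≤ 1 - t := by linarith
      exact hwedge c hcd.symm ⟨pos_of_mul_pos_right h1 ht, pos_of_mul_pos_right h2 ht⟩
    by_cases hin : C.coord v w q c ≤ 0 ∨ C.coord v q w c ≤ 0
    · rcases C.crosses_side_or hD hc hd hcd.ne ht0 ht1 hx1 hx2 h1 h2 h12.le hc1 hin with k | k
      · exact hT _ _ _ _ h.1 hcd k
      · exact hT _ _ _ _ h.2.2.1.symm hcd k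
    · push Not at hin
      refine h.2.2.2.2 c ⟨?_, ?_, ?_⟩
      · rw [eβ, posD]; exact hin.2
      · rw [eγ, posD]; linarith
      · rw [← C.o_rot q v c, eα, posD]; exact hin.1
  have m1 := main c d t hcd ht0 ht1 hx1 hx2
  have m2 := main d c (1 - t) hcd.symm (by linarith) (by linarith) (by rw [hx1]; ring)
    (by rw [hx2]; ring)
  have := mul_nonneg (sub_nonneg.2 ht1.le) (sub_nonneg.2 (not_lt.1 m1))
  have := mul_nonneg ht0.le (sub_nonneg.2 (not_lt.1 m2))
  linarith

/-- An edge missing in a subgraph with convex faces is adjacent to two triangles forming an angle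
less than `π` at its endpoints. -/
lemma ConvexFaces.angle_lt {T Q : SimpleGraph V} (hT : C.CrossingFree T) (hQT : Q ≤ T)
    (hQ : C.ConvexFaces Q) {v w q r : V} (hvw : ¬ Q.Adj v w) (h1 : C.IsTri T v w q)
    (h2 : C.IsTri T w v r) : 0 < C.o v r q := by
  by_contra hcon
  have hwq := h1.2.2.2.1
  have hrw : 0 < C.o v r w := h2.rot.2.2.2.1
  by_cases hv : C.Interior v
  -- The neighbour `z` of `v` strictly left of `vr` is not `w`, and it cannot lie in the angles of
  -- the two triangles; these cover the whole half-plane if the total angle is at least `π`.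
  · obtain ⟨z, hz, hpos⟩ := hQ.2 v hv r h2.2.1.ne.symm
    have hzw : z ≠ w := by rintro rfl; exact hvw hz
    rcases lt_or_gt_of_ne (C.o_ne_zero h1.1.ne hz.ne hzw.symm) with k | k
    · exact h2.rot.not_adj_in_wedge hT (hQT hz) hpos (by rw [C.o_swap]; linarith)
    · have hzq : C.o v z q ≤ 0 := not_lt.1 fun k' => h1.not_adj_in_wedge hT (hQT hz) k k'
      have := C.plucker v r w z q
      have p1 := mul_nonneg hrw.le (neg_nonneg.2 hzq)
      have p2 := mul_pos hpos hwq
      have p3 := mul_nonneg (neg_nonneg.2 (not_lt.1 hcon)) k.le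
      linarith
  · have hu : ∃ u, u ≠ v ∧ ∀ z, C.o v u z ≤ 0 := by
      by_contra hc
      push Not at hc
      exact hv ⟨⟨w, h1.1.ne.symm⟩, hc⟩
    -- All points are on one side of the line `vu`, so the angle is at most `π`; equality would put
    -- both `r` and `q` on this line, making them both equal to `u`.
    obtain ⟨u, huv, hu⟩ := hu
    have := C.plucker v u r w q
    have p1 := mul_nonneg (neg_nonneg.2 (hu r)) hwq.le
    have p2 := mul_nonneg (neg_nonneg.2 (hu w)) (neg_nonneg.2 (not_lt.1 hcon))
    have p3 := mul_nonneg (neg_nonneg.2 (hu q)) hrw.le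
    have z1 : C.o v u r * C.o v w q = 0 := by linarith
    have z3 : C.o v u q * C.o v r w = 0 := by linarith
    have z1' := (mul_eq_zero.1 z1).resolve_right hwq.ne'
    have z3' := (mul_eq_zero.1 z3).resolve_right hrw.ne'
    have hur : u = r := by
      by_contra hne
      exact C.o_ne_zero huv.symm h2.2.1.ne hne z1'
    have huq : u = q := by
      by_contra hne
      exact C.o_ne_zero huv.symm h1.2.2.1.ne.symm hne z3'
    subst hur
    subst huq
    rw [C.o_swap] at hrw
    linarith

/-- Because of the convex angles at `v` and `w`, a point of `qr` other than `q` and strictly on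
`q`'s side of `vw` is interior to the triangle `v w q`, which no edge enters. -/
lemma not_crosses_flip_aux {T : SimpleGraph V} (hT : C.CrossingFree T) {v w q r c d : V}
    (h : C.IsTri T v w q) (hv : 0 < C.o v r q) (hw : 0 < C.o w q r) (hcd : T.Adj c d)
    {s t : ℝ} (hs0 : 0 < s) (ht0 : 0 < t) (ht1 : t < 1)
    (hx : (1 - s) * C.x q + s * C.x r = (1 - t) * C.x c + t * C.x d)
    (hy : (1 - s) * C.y q + s * C.y r = (1 - t) * C.y c + t * C.y d)
    (hup : 0 < (1 - s) * C.o v w q + s * C.o v w r) : False := by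
  have hpos := h.2.2.2.1
  have hD' : C.o v q w ≠ 0 := by rw [C.o_swap]; exact neg_ne_zero.2 hpos.ne'
  have a1 := C.coord_combo (v := v) (w := w) (q := q) hx hy
  have a2 := C.coord_combo (v := v) (w := q) (q := w) hx hy
  rw [C.coord_outer, mul_zero, zero_add] at a1
  rw [C.coord_self hD', mul_one] at a2
  have hr1 : 0 < C.coord v w q r := div_pos hv hpos
  have hr2 : C.coord v q w r = C.o v w r / C.o v w q := C.coord_swap v w q r
  refine h.no_edge_through hT hcd ht0 ht1 a1 a2 (mul_pos hs0 hr1) ?_ ?_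
  · rw [hr2, show 1 - s + s * (C.o v w r / C.o v w q) =
      ((1 - s) * C.o v w q + s * C.o v w r) / C.o v w q by field_simp]
    exact div_pos hup hpos
  · have e : C.coord v w q r + C.coord v q w r = 1 - C.o w q r / C.o v w q := by
      rw [hr2, coord]
      field_simp
      have := C.o_eq_of_origin v w q r
      rw [C.o_swap v r q] at this
      linarith
    have := mul_pos hs0 (div_pos hw hpos)
    rw [show s * C.coord v w q r + (1 - s + s * C.coord v q w r) =
      1 - s + s * (C.coord v w q r + C.coord v q w r) by ring, e]
    linarith

/-- Every edge missing in a subgraph with convex faces can be flipped. -/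
lemma Triangulation.exists_flip [Finite V] {T Q : SimpleGraph V} (hT : C.Triangulation T)
    (hQT : Q ≤ T) (hQ : C.ConvexFaces Q) {v w : V} (hvw : T.Adj v w) (hQvw : ¬ Q.Adj v w) :
    ∃ q r, C.Crosses v w q r ∧
      C.CrossingFree (T.deleteEdges {s(v, w)} ⊔ SimpleGraph.edge q r) := by
  have hl : ∃ z, 0 < C.o v w z := by
    by_contra hcon
    push Not at hcon
    exact hQvw (hQ.1 w v hvw.ne.symm fun s => by rw [C.o_swap_left]; linarith [hcon s]).symm
  have hr : ∃ z, 0 < C.o w v z := by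
    by_contra hcon
    push Not at hcon
    exact hQvw (hQ.1 v w hvw.ne fun s => by rw [C.o_swap_left]; linarith [hcon s])
  obtain ⟨z, hz⟩ := hl
  obtain ⟨z', hz'⟩ := hr
  obtain ⟨q, hq⟩ := hT.exists_isTri hvw hz
  obtain ⟨r, hr⟩ := hT.exists_isTri hvw.symm hz'
  have av := hQ.angle_lt hT.1 hQT hQvw hq hr
  have aw := hQ.angle_lt hT.1 hQT (fun h => hQvw h.symm) hr hq
  have hqpos := hq.2.2.2.1
  have hrpos := hr.2.2.2.1
  rw [C.o_swap_left] at hrpos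
  have hX : C.Crosses v w q r := by
    refine ⟨mul_neg_of_pos_of_neg hqpos (by linarith), ?_⟩
    rw [C.o_rot v q r, C.o_rot w q r, C.o_swap v r q]
    have := mul_pos av aw
    linarith
  refine ⟨q, r, hX, (hT.1.mono (SimpleGraph.deleteEdges_le _)).sup_edge fun c d hcd hqr => ?_⟩
  rw [SimpleGraph.deleteEdges_adj] at hcd
  obtain ⟨hcd, hne⟩ := hcd
  have hne' : s(v, w) ≠ s(c, d) := fun h => hne (by simp [h])
  obtain ⟨s, t, hs0, hs1, ht0, ht1, hx, hy⟩ := hqr.exists_point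
  -- A point common to `cd` and `qr` is inside one of the two triangles, or else on `vw`, and in
  -- that case `cd` crosses `vw`.
  rcases lt_trichotomy ((1 - s) * C.o v w q + s * C.o v w r) 0 with k | k | k
  · refine not_crosses_flip_aux hT.1 hr aw ?_ hcd (s := 1 - s) (t := t) (by linarith) ht0 ht1
      (by linarith) (by linarith) ?_
    · exact av
    · rw [C.o_swap_left v w r, C.o_swap_left v w q]; linarith
  · have hD := hqpos.ne'
    have a1 := C.coord_combo (v := v) (w := w) (q := q) hx hy
    have a2 := C.coord_combo (v := v) (w := q) (q := w) hx hy
    have hD' : C.o v q w ≠ 0 := by rw [C.o_swap]; exact neg_ne_zero.2 hD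
    have hr2 : C.coord v q w r = C.o v w r / C.o v w q := C.coord_swap v w q r
    rw [C.coord_outer, mul_zero, zero_add] at a1
    rw [C.coord_self hD', mul_one, hr2, show 1 - s + s * (C.o v w r / C.o v w q) =
      ((1 - s) * C.o v w q + s * C.o v w r) / C.o v w q by field_simp, k, zero_div] at a2
    have hα : 0 < C.coord v w q r := div_pos av hqpos
    have hα1 : s * C.coord v w q r < 1 := by
      have e : C.coord v w q r + C.coord v q w r = 1 - C.o w q r / C.o v w q := by
        rw [hr2, coord]
        field_simp
        have := C.o_eq_of_origin v w q r
        rw [C.o_swap v r q] at this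
        linarith
      have e2 : s * C.coord v q w r = -(1 - s) := by
        rw [hr2]; field_simp; linarith
      have e3 : s * C.coord v w q r = 1 - s * (C.o w q r / C.o v w q) := by
        linear_combination s * e - e2
      have := mul_pos hs0 (div_pos aw hqpos)
      linarith
    refine hT.1 _ _ _ _ hvw hcd
      (C.crosses_of_common_point hvw.ne hcd.ne hne' (mul_pos hs0 hα) hα1 ht0 ht1 ?_ ?_)
    · have e : ∀ a, C.x a = C.x v + C.coord v w q a * (C.x w - C.x v) +
          C.coord v q w a * (C.x q - C.x v) := by
        intro a; rw [C.coord_swap v w q a]; exact C.frame_x v w q a hD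
      linear_combination (C.x w - C.x v) * a1 + (C.x q - C.x v) * a2 - (1 - t) * e c - t * e d
    · have e : ∀ a, C.y a = C.y v + C.coord v w q a * (C.y w - C.y v) +
          C.coord v q w a * (C.y q - C.y v) := by
        intro a; rw [C.coord_swap v w q a]; exact C.frame_y v w q a hD
      linear_combination (C.y w - C.y v) * a1 + (C.y q - C.y v) * a2 - (1 - t) * e c - t * e d
  · exact not_crosses_flip_aux hT.1 hq av aw hcd hs0 ht0 ht1 hx hy k

lemma CrossingFree.exists_triangulation [Finite V] {G : SimpleGraph V} (hG : C.CrossingFree G) :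
    ∃ T, C.Triangulation T ∧ G ≤ T := by
  obtain ⟨T, h1, h2⟩ := (Set.toFinite {G | C.CrossingFree G}).exists_le_maximal hG
  exact ⟨T, h2, h1⟩

/-- A crossing-free graph with convex faces that misses at least `j` edges of some triangulation
containing it is contained in at least `2 ^ j` triangulations. -/
lemma two_pow_le_ncard [Fintype V] [DecidableEq V] (j : ℕ) : ∀ {Q T : SimpleGraph V},
    C.Triangulation T → Q ≤ T → C.ConvexFaces Q → j ≤ (edges T \ edges Q).card →
    2 ^ j ≤ {T' | C.Triangulation T' ∧ Q ≤ T'}.ncard := by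
  induction j with
  | zero =>
    intro Q T hT hQT _ _
    exact (Set.ncard_pos (Set.toFinite _)).2 ⟨T, hT, hQT⟩
  | succ j ih =>
    intro Q T hT hQT hQ hj
    obtain ⟨e, he⟩ : (edges T \ edges Q).Nonempty := Finset.card_pos.1 (by omega)
    induction e using Sym2.ind with
    | _ v w =>
      rw [Finset.mem_sdiff, mem_edges, mem_edges] at he
      obtain ⟨hvw, hQvw⟩ := he
      obtain ⟨q, r, hX, hCF⟩ := hT.exists_flip hQT hQ hvw hQvw
      obtain ⟨T', hT', hle⟩ := hCF.exists_triangulation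
      -- Induction is applied to `Q` with `vw` inside `T`, and to `Q` with `qr` inside a
      -- triangulation `T'` extending the flipped graph. In both cases the missing edges other than
      -- `vw` remain missing. No triangulation is counted twice, since `vw` and `qr` cross.
      have hcard : j ≤ ((edges T \ edges Q).erase s(v, w)).card := by
        rw [Finset.card_erase_of_mem (by simpa [mem_edges] using ⟨hvw, hQvw⟩)]
        omega
      have hqr : q ≠ r := hX.ne.2.2.2.2.2
      have hedge : ∀ {a b c d : V}, (Q ⊔ SimpleGraph.edge a b).Adj c d →
          Q.Adj c d ∨ s(c, d) = s(a, b) := by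
        intro a b c d h
        rw [SimpleGraph.sup_adj, SimpleGraph.edge_adj] at h
        rcases h with h | h
        · exact Or.inl h
        · exact Or.inr (Sym2.eq_iff.2 h.1)
      have hadj : ∀ {a b : V} {G : SimpleGraph V}, a ≠ b → (G ⊔ SimpleGraph.edge a b).Adj a b := by
        intro a b G h
        rw [SimpleGraph.sup_adj, SimpleGraph.edge_adj]
        exact Or.inr ⟨Or.inl ⟨rfl, rfl⟩, h⟩
      have h1 := ih (Q := Q ⊔ SimpleGraph.edge v w) hT
        (sup_le hQT (by
          intro a b hab
          rw [SimpleGraph.edge_adj] at hab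
          rcases hab.1 with ⟨rfl, rfl⟩ | ⟨rfl, rfl⟩
          · exact hvw
          · exact hvw.symm)) (hQ.mono le_sup_left) (hcard.trans (Finset.card_le_card (by
          intro e he
          induction e using Sym2.ind with
          | _ a b =>
            simp only [Finset.mem_erase, Finset.mem_sdiff, mem_edges] at he ⊢
            refine ⟨he.2.1, fun h => ?_⟩
            rcases hedge h with h | h
            · exact he.2.2 h
            · exact he.1 h)))
      have h2 := ih (Q := Q ⊔ SimpleGraph.edge q r) hT'
        (le_trans (sup_le_sup_right (by
          intro a b hab
          rw [SimpleGraph.deleteEdges_adj]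
          refine ⟨hQT hab, fun h => ?_⟩
          rcases Sym2.eq_iff.1 (Set.mem_singleton_iff.1 h) with ⟨rfl, rfl⟩ | ⟨rfl, rfl⟩
          · exact hQvw hab
          · exact hQvw hab.symm) _) hle) (hQ.mono le_sup_left)
        (hcard.trans (Finset.card_le_card (by
          intro e he
          induction e using Sym2.ind with
          | _ a b =>
            simp only [Finset.mem_erase, Finset.mem_sdiff, mem_edges] at he ⊢
            refine ⟨hle (Or.inl ?_), fun h => ?_⟩
            · rw [SimpleGraph.deleteEdges_adj]
              exact ⟨he.2.1, he.1⟩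
            rcases hedge h with h | h
            · exact he.2.2 h
            · rcases Sym2.eq_iff.1 h with ⟨rfl, rfl⟩ | ⟨rfl, rfl⟩
              · exact hT.1 _ _ _ _ hvw he.2.1 hX
              · exact hT.1 _ _ _ _ hvw he.2.1 hX.swap_right)))
      have hdisj : Disjoint {T' | C.Triangulation T' ∧ Q ⊔ SimpleGraph.edge v w ≤ T'}
          {T' | C.Triangulation T' ∧ Q ⊔ SimpleGraph.edge q r ≤ T'} := by
        rw [Set.disjoint_left]
        rintro T'' ⟨k1, k2⟩ ⟨-, k3⟩
        exact k1.1 _ _ _ _ (k2 (hadj hvw.ne)) (k3 (hadj hqr)) hX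
      have hsub : {T' | C.Triangulation T' ∧ Q ⊔ SimpleGraph.edge v w ≤ T'} ∪
          {T' | C.Triangulation T' ∧ Q ⊔ SimpleGraph.edge q r ≤ T'} ⊆
          {T' | C.Triangulation T' ∧ Q ≤ T'} := by
        rintro T'' (⟨k1, k2⟩ | ⟨k1, k2⟩)
        · exact ⟨k1, le_sup_left.trans k2⟩
        · exact ⟨k1, le_sup_left.trans k2⟩
      have := Set.ncard_le_ncard hsub (Set.toFinite _)
      rw [Set.ncard_union_eq hdisj (Set.toFinite _) (Set.toFinite _)] at this
      rw [pow_succ]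
      omega

end PointConfig

/-! ### Weighted double counting and numerical estimates. -/

namespace PointConfig

variable {V : Type*} {C : PointConfig V}

/-- Weighted double counting of pairs of a crossing-free graph and a triangulation containing it. -/
lemma card_crossingFree_le [Fintype V] [DecidableEq V] {B : ℝ}
    (hB : ∀ T, C.Triangulation T → ∃ P ≤ T, C.ConvexFaces P ∧
      (2 : ℝ) ^ (edges P).card * (3 / 2) ^ (edges T \ edges P).card ≤ B) :
    ({G | C.CrossingFree G}.ncard : ℝ) ≤ B * ({T | C.Triangulation T}.ncard : ℝ) := by
  classical
  have := Fintype.ofFinite (SimpleGraph V)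
  set cf : Finset (SimpleGraph V) := Finset.univ.filter fun G => C.CrossingFree G with hcf
  set tri : Finset (SimpleGraph V) := Finset.univ.filter fun T => C.Triangulation T with htri
  have e1 : {G | C.CrossingFree G}.ncard = cf.card := by
    rw [← Set.ncard_coe_finset]; congr 1; ext; simp [hcf]
  have e2 : {T | C.Triangulation T}.ncard = tri.card := by
    rw [← Set.ncard_coe_finset]; congr 1; ext; simp [htri]
  let supp : SimpleGraph V → Finset (SimpleGraph V) := fun G => tri.filter fun T => G ≤ T
  have e3 : ∀ Q, {T' | C.Triangulation T' ∧ Q ≤ T'}.ncard = (supp Q).card := by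
    intro Q
    rw [← Set.ncard_coe_finset]; congr 1; ext; simp [htri, supp]
  have hsupp : ∀ G ∈ cf, (supp G).Nonempty := by
    intro G hG
    obtain ⟨T, hT, hle⟩ := CrossingFree.exists_triangulation (Finset.mem_filter.1 hG).2
    exact ⟨T, by simpa [supp, htri] using ⟨hT, hle⟩⟩
  -- Each graph distributes unit weight evenly over the triangulations containing it.
  have hsum : (cf.card : ℝ) = ∑ T ∈ tri, ∑ G ∈ cf.filter (· ≤ T), ((supp G).card : ℝ)⁻¹ := by
    rw [Finset.sum_comm' (t' := cf) (s' := supp) (by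
      intro T G; simp only [supp, Finset.mem_filter]; tauto)]
    rw [Finset.cast_card]
    refine Finset.sum_congr rfl fun G hG => ?_
    rw [Finset.sum_const, nsmul_eq_mul, mul_inv_cancel₀]
    exact_mod_cast (Finset.card_pos.2 (hsupp G hG)).ne'
  have hT : ∀ T ∈ tri, ∑ G ∈ cf.filter (· ≤ T), ((supp G).card : ℝ)⁻¹ ≤ B := by
    intro T hT
    have hT' := (Finset.mem_filter.1 hT).2
    obtain ⟨P, hPT, hP, hle⟩ := hB T hT'
    refine le_trans ?_ hle
    -- Expanding `∏ (1 + c e)` over the edges of `T` gives a sum over edge sets `A` of `∏ c e` over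
    -- the edges outside `A`. For the edge set of `G` this term is `2` to the power `-|T \ (G ⊔
    -- P)|`, which dominates the weight `T` receives from `G`.
    let c : Sym2 V → ℝ := fun e => if e ∈ edges P then 1 else 1 / 2
    have hc0 : ∀ e, 0 ≤ c e := fun e => by simp only [c]; split_ifs <;> norm_num
    have hsub : ∀ {G H : SimpleGraph V}, G ≤ H → edges G ⊆ edges H := by
      intro G H h e he
      induction e using Sym2.ind with
      | _ a b => rw [mem_edges] at *; exact h he
    have hprod : ∏ e ∈ edges T, (1 + c e) =
        (2 : ℝ) ^ (edges P).card * (3 / 2) ^ (edges T \ edges P).card := by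
      rw [← Finset.prod_sdiff (hsub hPT), mul_comm]
      congr 1
      · rw [Finset.prod_congr rfl (g := fun _ => (2 : ℝ)) (fun e he => by
          simp only [c, if_pos he]; norm_num), Finset.prod_const]
      · rw [Finset.prod_congr rfl (g := fun _ => (3 / 2 : ℝ)) (fun e he => by
          simp only [c, if_neg (Finset.mem_sdiff.1 he).2]; norm_num), Finset.prod_const]
    rw [← hprod, Finset.prod_add]
    simp only [Finset.prod_const_one, one_mul]
    have hinj : Set.InjOn (edges (V := V)) (cf.filter (· ≤ T) : Finset _) := by
      intro G _ H _ h
      ext a b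
      rw [← mem_edges, ← mem_edges, h]
    refine le_trans ?_ (Finset.sum_le_sum_of_subset_of_nonneg
      (s := (cf.filter (· ≤ T)).image edges) (fun A hA => ?_)
      (fun A _ _ => Finset.prod_nonneg fun e _ => hc0 e))
    · rw [Finset.sum_image hinj]
      refine Finset.sum_le_sum fun G hG => ?_
      simp only [Finset.mem_filter] at hG
      have h1 := two_pow_le_ncard (edges T \ edges (G ⊔ P)).card hT' (sup_le hG.2 hPT)
        (hP.mono le_sup_right) le_rfl
      rw [e3] at h1
      have h2 : (supp (G ⊔ P)).card ≤ (supp G).card := Finset.card_le_card fun T' hT' => by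
        simp only [supp, Finset.mem_filter] at hT' ⊢
        exact ⟨hT'.1, le_sup_left.trans hT'.2⟩
      have h3 : ∏ e ∈ edges T \ edges G, c e =
          (1 / 2 : ℝ) ^ (edges T \ edges (G ⊔ P)).card := by
        rw [← Finset.prod_const, Finset.prod_ite, Finset.prod_const_one, one_mul]
        refine Finset.prod_congr ?_ fun _ _ => rfl
        ext e
        induction e using Sym2.ind with
        | _ a b =>
          simp only [Finset.mem_filter, Finset.mem_sdiff, mem_edges, SimpleGraph.sup_adj]
          tauto
      rw [h3, one_div, inv_pow]
      refine inv_anti₀ (by positivity) ?_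
      exact_mod_cast h1.trans h2
    · obtain ⟨G, hG, rfl⟩ := Finset.mem_image.1 hA
      exact Finset.mem_powerset.2 (hsub (Finset.mem_filter.1 hG).2)
  rw [e1, e2, hsum, mul_comm]
  calc _ ≤ ∑ T ∈ tri, B := Finset.sum_le_sum hT
    _ = _ := by rw [Finset.sum_const, nsmul_eq_mul]

/-- From `2 = (3/2)(4/3)` the left side is `(3/2)^(k+m) (4/3)^k`, increasing in `k + m` and `k`. At
the extreme values use `8 = (3/2)^3 (4/3)^3` and `(2/3)(3/4)^2 = 3/8`. -/
lemma weight_le_eight_pow {k m h N : ℕ} (h1 : k + m + h ≤ 3 * N) (h2 : k + 2 * h ≤ 3 * N) :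
    (2 : ℝ) ^ k * (3 / 2) ^ m ≤ 8 ^ N * (3 / 8) ^ h := by
  obtain ⟨a, ha⟩ := Nat.exists_eq_add_of_le h1
  obtain ⟨b, hb⟩ := Nat.exists_eq_add_of_le h2
  have e : (8 : ℝ) ^ N = (3 / 2) ^ (3 * N) * (4 / 3) ^ (3 * N) := by
    rw [← mul_pow, pow_mul]; norm_num
  have e2 : (8 : ℝ) ^ N * (3 / 8) ^ h =
      2 ^ k * (3 / 2) ^ m * ((3 / 2) ^ a * (4 / 3) ^ b) := by
    have e3 : (2 : ℝ) ^ k = (3 / 2) ^ k * (4 / 3) ^ k := by rw [← mul_pow]; norm_num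
    have e4 : (3 / 2 : ℝ) ^ h * (4 / 3) ^ (2 * h) * (3 / 8) ^ h = 1 := by
      rw [pow_mul, ← mul_pow, ← mul_pow]; norm_num
    rw [e, e3]
    conv_lhs => rw [ha]
    conv_lhs => enter [1, 2]; rw [← ha, hb]
    simp only [pow_add]
    linear_combination ((3 / 2 : ℝ) ^ k * (3 / 2) ^ m * (3 / 2) ^ a * (4 / 3) ^ k * (4 / 3) ^ b) * e4
  rw [e2]
  have h3 : (1 : ℝ) ≤ (3 / 2) ^ a := one_le_pow₀ (by norm_num)
  have h4 : (1 : ℝ) ≤ (4 / 3) ^ b := one_le_pow₀ (by norm_num)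
  exact le_mul_of_one_le_right (by positivity) (by nlinarith)

/-- The same rewriting, with `k` at most `5N/2 - h`; squaring avoids the half-integral exponent. The
constants come from `(9/4)^3 (4/3)^5 = 48 = (4√3)^2` and `(2/3)(3/4) = 1/2`. -/
lemma weight_le_sqrt_pow {k m h N : ℕ} (h1 : k + m + h ≤ 3 * N)
    (h2 : 2 * k + 2 * h ≤ 5 * N) :
    (2 : ℝ) ^ k * (3 / 2) ^ m ≤ (4 * Real.sqrt 3) ^ N / 2 ^ h := by
  obtain ⟨a, ha⟩ := Nat.exists_eq_add_of_le h1
  obtain ⟨b, hb⟩ := Nat.exists_eq_add_of_le h2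
  rw [le_div_iff₀ (by positivity)]
  refine le_of_sq_le_sq ?_ (by positivity)
  have e : ((4 * Real.sqrt 3) ^ N) ^ 2 = (9 / 4 : ℝ) ^ (3 * N) * (4 / 3) ^ (5 * N) := by
    rw [← pow_mul, mul_comm N 2, pow_mul, mul_pow, Real.sq_sqrt (by norm_num), pow_mul, pow_mul,
      ← mul_pow]
    norm_num
  rw [e, ha, hb]
  have e2 : (9 / 4 : ℝ) ^ (k + m + h + a) * (4 / 3) ^ (2 * k + 2 * h + b) =
      (2 ^ k * (3 / 2) ^ m * 2 ^ h) ^ 2 * ((9 / 4) ^ a * (4 / 3) ^ b) := by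
    have e3 : ∀ n : ℕ, ((2 : ℝ) ^ n) ^ 2 = (9 / 4) ^ n * (4 / 3) ^ (2 * n) := by
      intro n
      rw [pow_mul (4 / 3 : ℝ), ← mul_pow, ← pow_mul, mul_comm n 2, pow_mul]; norm_num
    have e4 : ((3 / 2 : ℝ) ^ m) ^ 2 = (9 / 4) ^ m := by
      rw [← pow_mul, mul_comm m 2, pow_mul]; norm_num
    rw [mul_pow, mul_pow, e3, e3, e4]
    simp only [pow_add]
    ring
  rw [e2]
  have h3 : (1 : ℝ) ≤ (9 / 4) ^ a := one_le_pow₀ (by norm_num)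
  have h4 : (1 : ℝ) ≤ (4 / 3) ^ b := one_le_pow₀ (by norm_num)
  exact le_mul_of_one_le_right (by positivity) (by nlinarith)

lemma edges_card_add [Fintype V] [DecidableEq V] {T P : SimpleGraph V} (h : P ≤ T) :
    (edges P).card + (edges T \ edges P).card = (edges T).card := by
  rw [add_comm]
  refine Finset.card_sdiff_add_card_eq_card fun e he => ?_
  induction e using Sym2.ind with
  | _ a b => rw [mem_edges] at *; exact h he

/-- An interior point lies in an open triangle spanned by other points. -/
lemma Interior.exists_triangle [Finite V] {v : V} (h : C.Interior v) :
    ∃ a b c, 0 < C.o v a b ∧ 0 < C.o v b c ∧ 0 < C.o v c a := by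
  classical
  have := Fintype.ofFinite V
  obtain ⟨⟨w, hw⟩, h⟩ := h
  obtain ⟨z, hz⟩ := h w hw
  obtain ⟨κ, hκ⟩ := C.exists_slope v w
  -- `b` is the last point counterclockwise in the half-plane left of `vw`, so a point `c` left of
  -- `vb` must be right of `vw`.
  obtain ⟨b, hb, hmin⟩ := (Finset.univ.filter fun z => 0 < C.o v w z).exists_min_image κ
    ⟨z, by simpa using hz⟩
  simp only [Finset.mem_filter, Finset.mem_univ, true_and] at hb hmin
  obtain ⟨c, hc⟩ := h b (C.ne_of_o_ne_zero hb.ne').2.1.symm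
  refine ⟨w, b, c, hb, hc, ?_⟩
  have h1 : ¬ 0 < C.o v w c := fun h1 => by
    have := hκ c b h1 hb (hmin c h1)
    rw [C.o_swap] at this
    linarith
  have hwc : w ≠ c := by
    rintro rfl
    rw [C.o_swap] at hc
    linarith
  have h2 := C.o_ne_zero hw.symm (C.ne_of_o_ne_zero hc.ne').2.1 hwc
  rw [C.o_swap]
  have := lt_of_le_of_ne (not_lt.1 h1) h2
  linarith

end PointConfig

/-! ### Transfer to the Euclidean plane. -/

/-- Orientation of points of the plane. -/
def planeOrient (a b c : Plane) : ℝ := (b 0 - a 0) * (c 1 - a 1) - (b 1 - a 1) * (c 0 - a 0)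

lemma plane_ext {a b : Plane} (h0 : a 0 = b 0) (h1 : a 1 = b 1) : a = b := by
  ext i; fin_cases i
  · exact h0
  · exact h1

lemma collinear_of_planeOrient_eq_zero {a b c : Plane} (hab : a ≠ b)
    (h : planeOrient a b c = 0) : Collinear ℝ ({a, b, c} : Set Plane) := by
  rw [collinear_iff_of_mem (p₀ := a) (by simp)]
  refine ⟨b - a, ?_⟩
  have hc : ∃ r : ℝ, c = r • (b - a) +ᵥ a := by
    unfold planeOrient at h
    by_cases h0 : b 0 - a 0 = 0
    · have h1 : b 1 - a 1 ≠ 0 := fun h1 =>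
        hab (plane_ext (sub_eq_zero.1 h0).symm (sub_eq_zero.1 h1).symm)
      refine ⟨(c 1 - a 1) / (b 1 - a 1), plane_ext ?_ ?_⟩
      · rw [h0, zero_mul, zero_sub, neg_eq_zero] at h
        have := (mul_eq_zero.1 h).resolve_left h1
        simp [h0]; linarith
      · simp; field_simp; ring
    · refine ⟨(c 0 - a 0) / (b 0 - a 0), plane_ext ?_ ?_⟩
      · simp; field_simp; ring
      · simp; field_simp; linarith
  intro p hp
  simp only [Set.mem_insert_iff, Set.mem_singleton_iff] at hp
  rcases hp with rfl | rfl | rfl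
  · exact ⟨0, by simp⟩
  · exact ⟨1, by simp⟩
  · exact hc

/-- A shear separates the abscissae of finitely many points. -/
lemma exists_shear (S : Finset Plane) :
    ∃ t : ℝ, ∀ a ∈ S, ∀ b ∈ S, a 0 + t * a 1 = b 0 + t * b 1 → a = b := by
  classical
  -- For two points with different ordinates a single value of `t` equalizes the sheared abscissae;
  -- avoid these finitely many values.
  obtain ⟨t, ht⟩ := Infinite.exists_notMem_finset
    ((S ×ˢ S).image fun e : Plane × Plane => (e.1 0 - e.2 0) / (e.2 1 - e.1 1))
  refine ⟨t, fun a ha b hb hab => ?_⟩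
  by_cases h1 : b 1 - a 1 = 0
  · have h1' := sub_eq_zero.1 h1
    rw [h1'] at hab
    exact plane_ext (by linarith) h1'.symm
  · exfalso
    refine ht (Finset.mem_image.2 ⟨(a, b), Finset.mk_mem_product ha hb, ?_⟩)
    rw [div_eq_iff h1]
    linarith

variable {S : Finset Plane}

/-- The configuration of the points of `S`, sheared. -/
def configOf (hS : GeneralPosition S) (t : ℝ)
    (ht : ∀ a ∈ S, ∀ b ∈ S, a 0 + t * a 1 = b 0 + t * b 1 → a = b) : PointConfig S where
  pos v := ((v : Plane) 0 + t * (v : Plane) 1, (v : Plane) 1)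
  general a b c hab hac hbc h0 := by
    refine hS a a.2 b b.2 c c.2 (fun h => hab (Subtype.ext h)) (fun h => hac (Subtype.ext h))
      (fun h => hbc (Subtype.ext h))
      (collinear_of_planeOrient_eq_zero (fun h => hab (Subtype.ext h)) ?_)
    simp only [orient] at h0
    unfold planeOrient
    linear_combination h0
  fst_injective a b h := Subtype.ext (ht a a.2 b b.2 h)

/-- A labelled point on the line through two others is one of them. -/
lemma eq_or_eq_of_mem_segment (hS : GeneralPosition S) {c d e : S} (hcd : c ≠ d) {u : ℝ}
    (h : (e : Plane) = (1 - u) • (c : Plane) + u • (d : Plane)) :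
    e = c ∨ e = d := by
  obtain ⟨t, ht⟩ := exists_shear S
  by_contra hne
  push Not at hne
  refine (configOf hS t ht).o_ne_zero hcd hne.1.symm hne.2.symm ?_
  simp only [PointConfig.o_def, PointConfig.x, PointConfig.y, configOf]
  rw [h]
  simp
  ring

section

variable (hS : GeneralPosition S) (t : ℝ)
  (ht : ∀ a ∈ S, ∀ b ∈ S, a 0 + t * a 1 = b 0 + t * b 1 → a = b)

lemma configOf_o (a b c : S) : (configOf hS t ht).o a b c = planeOrient a b c := by
  simp only [PointConfig.o, configOf, orient, planeOrient]; ring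

lemma configOf_x (a : S) : (configOf hS t ht).x a = (a : Plane) 0 + t * (a : Plane) 1 := rfl

lemma configOf_y (a : S) : (configOf hS t ht).y a = (a : Plane) 1 := rfl

lemma common_point_iff (a b c d : S) (s u : ℝ) :
    (1 - s) • (a : Plane) + s • (b : Plane) = (1 - u) • (c : Plane) + u • (d : Plane) ↔
      (1 - s) * (configOf hS t ht).x a + s * (configOf hS t ht).x b =
          (1 - u) * (configOf hS t ht).x c + u * (configOf hS t ht).x d ∧
        (1 - s) * (configOf hS t ht).y a + s * (configOf hS t ht).y b =
          (1 - u) * (configOf hS t ht).y c + u * (configOf hS t ht).y d := by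
  simp only [configOf_x, configOf_y]
  constructor
  · intro h
    have h0 := congrArg (fun p : Plane => p 0) h
    have h1 := congrArg (fun p : Plane => p 1) h
    simp at h0 h1
    exact ⟨by linear_combination h0 + t * h1, h1⟩
  · rintro ⟨h0, h1⟩
    refine plane_ext ?_ ?_
    · simp; linear_combination h0 - t * h1
    · simpa using h1

/-- A common point interior to both segments is a crossing. Any other common point is an endpoint of
one of them, and general position makes it an endpoint of the other too. -/
lemma isCrossingFree_iff (G : SimpleGraph S) :
    IsCrossingFree G ↔ (configOf hS t ht).CrossingFree G := by
  constructor
  · intro h a b c d hab hcd hX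
    obtain ⟨s, u, hs0, hs1, hu0, hu1, hx, hy⟩ := hX.exists_point
    have hp := (common_point_iff hS t ht a b c d s u).2 ⟨hx, hy⟩
    have hne : s(a, b) ≠ s(c, d) := by
      rw [Ne, Sym2.eq_iff]
      rintro (⟨rfl, -⟩ | ⟨rfl, -⟩)
      · exact hX.ne.2.1 rfl
      · exact hX.ne.2.2.1 rfl
    have hmem : (1 - s) • (a : Plane) + s • (b : Plane) ∈
        ({(a : Plane), (b : Plane)} : Set Plane) ∩ {(c : Plane), (d : Plane)} :=
      h a b c d hab hcd hne
      ⟨⟨1 - s, s, by linarith, hs0.le, by ring, rfl⟩,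
        ⟨1 - u, u, by linarith, hu0.le, by ring, hp.symm⟩⟩
    have hab' : (b : Plane) - a ≠ 0 := sub_ne_zero.2 fun h => hab.ne (Subtype.ext h.symm)
    rcases hmem.1 with h1 | h1
    · have : s • ((b : Plane) - a) = 0 := by
        rw [smul_sub, ← sub_eq_zero.2 h1]; module
      exact (smul_ne_zero hs0.ne' hab') this
    · have : (1 - s) • ((b : Plane) - a) = 0 := by
        rw [smul_sub, ← sub_eq_zero.2 (Set.mem_singleton_iff.1 h1).symm]; module
      exact (smul_ne_zero (by linarith) hab') this
  · intro h a b c d hab hcd hne p hp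
    obtain ⟨⟨s', s, hs', hs, hs1, hp1⟩, ⟨u', u, hu', hu, hu1, hp2⟩⟩ := hp
    obtain rfl : s' = 1 - s := by linarith
    obtain rfl : u' = 1 - u := by linarith
    have he : (1 - s) • (a : Plane) + s • (b : Plane) = (1 - u) • (c : Plane) + u • (d : Plane) :=
      hp1.trans hp2.symm
    have endpoint : ∀ (a b : S) (s : ℝ), 0 ≤ s → 0 ≤ 1 - s →
        (1 - s) • (a : Plane) + s • (b : Plane) = p →
        (0 < s ∧ s < 1) ∨ p = a ∨ p = b := by
      intro a b s h0 h1 hp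
      rcases h0.eq_or_lt with rfl | h0
      · right; left; rw [← hp]; simp
      rcases h1.eq_or_lt with h1 | h1
      · right; right; rw [← hp, ← h1, show s = 1 by linarith]; simp
      · left; exact ⟨h0, by linarith⟩
    have vertex : ∀ (e c d : S) (u : ℝ), c ≠ d → p = e →
        (1 - u) • (c : Plane) + u • (d : Plane) = p → p = c ∨ p = d := by
      intro e c d u hcd h1 h2
      rcases eq_or_eq_of_mem_segment hS hcd (h1.symm.trans h2.symm) with rfl | rfl
      · exact Or.inl h1
      · exact Or.inr h1
    have goal : (p = a ∨ p = b) ∧ (p = c ∨ p = d) := by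
      rcases endpoint a b s hs hs' hp1 with h1 | h1
      · rcases endpoint c d u hu hu' hp2 with h2 | h2
        · obtain ⟨hx, hy⟩ := (common_point_iff hS t ht a b c d s u).1 he
          exact absurd ((configOf hS t ht).crosses_of_common_point hab.ne hcd.ne hne h1.1 h1.2
            h2.1 h2.2 hx hy) (h a b c d hab hcd)
        · refine ⟨?_, h2⟩
          rcases h2 with h2 | h2
          · exact vertex c a b s hab.ne h2 hp1
          · exact vertex d a b s hab.ne h2 hp1
      · refine ⟨h1, ?_⟩
        rcases h1 with h1 | h1
        · exact vertex a c d u hcd.ne h1 hp2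
        · exact vertex b c d u hcd.ne h1 hp2
    exact goal

lemma isTriangulation_iff (T : SimpleGraph S) :
    IsTriangulation T ↔ (configOf hS t ht).Triangulation T := by
  have : (IsCrossingFree : SimpleGraph S → Prop) = (configOf hS t ht).CrossingFree :=
    funext fun G => propext (isCrossingFree_iff hS t ht G)
  rw [IsTriangulation, PointConfig.Triangulation, this]

end

lemma continuous_planeOrient (a b : Plane) : Continuous fun p => planeOrient a b p := by
  unfold planeOrient; fun_prop

lemma mem_interior_of_triangle {K : Set Plane} (hK : Convex ℝ K) {a b c v : Plane} (ha : a ∈ K)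
    (hb : b ∈ K) (hc : c ∈ K) (h1 : 0 < planeOrient a b v) (h2 : 0 < planeOrient b c v)
    (h3 : 0 < planeOrient c a v) : v ∈ interior K := by
  rw [mem_interior]
  refine ⟨{p | 0 < planeOrient a b p} ∩ {p | 0 < planeOrient b c p} ∩
    {p | 0 < planeOrient c a p}, ?_, ?_, ⟨h1, h2⟩, h3⟩
  · rintro p ⟨⟨h1, h2⟩, h3⟩
    simp only [Set.mem_ofPred_eq] at h1 h2 h3
    have hD : 0 < planeOrient a b p + planeOrient b c p + planeOrient c a p := by linarith
    -- `D` is twice the area of `a b c`, and the three orientations divided by `D` are the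
    -- barycentric coordinates of `p`.
    set D := planeOrient a b p + planeOrient b c p + planeOrient c a p with hDdef
    have hsum := hK.sum_mem (t := Finset.univ) (w := ![planeOrient b c p / D,
      planeOrient c a p / D, planeOrient a b p / D]) (z := ![a, b, c])
      (by intro i _; fin_cases i <;> simp <;> positivity)
      (by simp [Fin.sum_univ_three]; field_simp; rw [hDdef]; ring)
      (by intro i _; fin_cases i <;> simpa)
    have hp : p = ∑ i, (![planeOrient b c p / D, planeOrient c a p / D, planeOrient a b p / D] i) •
        (![a, b, c] i) := by
      refine plane_ext ?_ ?_
      · simp [Fin.sum_univ_three]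
        field_simp
        rw [hDdef]
        simp only [planeOrient]
        ring
      · simp [Fin.sum_univ_three]
        field_simp
        rw [hDdef]
        simp only [planeOrient]
        ring
    rw [hp]
    exact hsum
  · exact (((isOpen_lt continuous_const (continuous_planeOrient a b)).inter
      (isOpen_lt continuous_const (continuous_planeOrient b c))).inter
      (isOpen_lt continuous_const (continuous_planeOrient c a)))

/-- A point surrounded in the sense of `Interior` is inside an open triangle of points, hence not on
the frontier. One inequality suffices, since the edge bounds only get weaker when the number of hull
vertices is replaced by something smaller. -/
lemma hullCount_le (hS : GeneralPosition S) (t : ℝ)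
    (ht : ∀ a ∈ S, ∀ b ∈ S, a 0 + t * a 1 = b 0 + t * b 1 → a = b) :
    hullCount S ≤ (configOf hS t ht).hullVertices.card := by
  rw [hullCount, ← Set.ncard_coe_finset, ← Set.ncard_image_of_injective _ Subtype.val_injective]
  refine Set.ncard_le_ncard ?_ (Set.toFinite _)
  rintro p ⟨hp, hfr⟩
  refine ⟨⟨p, hp⟩, ?_, rfl⟩
  simp only [PointConfig.hullVertices, Finset.coe_filter, Finset.mem_univ, true_and,
    Set.mem_ofPred_eq]
  intro hint
  obtain ⟨a, b, c, h1, h2, h3⟩ := hint.exists_triangle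
  rw [configOf_o] at h1 h2 h3
  refine hfr.2 (mem_interior_of_triangle (convex_convexHull ℝ _) (subset_convexHull ℝ _ a.2)
    (subset_convexHull ℝ _ b.2) (subset_convexHull ℝ _ c.2) ?_ ?_ ?_)
  · simp only [planeOrient] at h1 ⊢; linarith
  · simp only [planeOrient] at h2 ⊢; linarith
  · simp only [planeOrient] at h3 ⊢; linarith

lemma pg_le (hS : GeneralPosition S) {B : ℝ}
    (hB : ∀ k m H : ℕ, hullCount S ≤ H → k + m + H ≤ 3 * S.card → k + 2 * H ≤ 3 * S.card →
      2 * k + 2 * H ≤ 5 * S.card → (2 : ℝ) ^ k * (3 / 2) ^ m ≤ B) :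
    (pg S : ℝ) ≤ B * tr S := by
  classical
  obtain ⟨t, ht⟩ := exists_shear S
  have key := PointConfig.card_crossingFree_le (C := configOf hS t ht) (B := B) fun T hT => by
    obtain ⟨P, hPT, hP, h1, h2⟩ := hT.exists_sparse_convexFaces
    have h3 := hT.card_edges_add_le
    rw [← PointConfig.edges_card_add hPT] at h3
    rw [Fintype.card_coe] at h1 h2 h3
    exact ⟨P, hPT, hP, hB _ _ _ (hullCount_le hS t ht) h3 h1 h2⟩
  simp only [← isCrossingFree_iff, ← isTriangulation_iff] at key
  exact key

lemma tr_pos (hS : GeneralPosition S) : 0 < tr S := by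
  obtain ⟨t, ht⟩ := exists_shear S
  have hbot : (configOf hS t ht).CrossingFree ⊥ := fun a b c d h => absurd h (by simp)
  obtain ⟨T, hT, -⟩ := hbot.exists_triangulation
  exact (Set.ncard_pos (Set.toFinite _)).2 ⟨T, (isTriangulation_iff hS t ht T).2 hT⟩

end PlaneGraphs

theorem mainTheorem2 (S : Finset PlaneGraphs.Plane) (hS : PlaneGraphs.GeneralPosition S)
    (N h : ℕ) (hN : S.card = N) (hh : PlaneGraphs.hullCount S = h) :
    ((h : ℝ) ≤ (N : ℝ) / 2 →
      (PlaneGraphs.pg S : ℝ) ≤ (4 * Real.sqrt 3) ^ N / 2 ^ h * (PlaneGraphs.tr S : ℝ) ∧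
      (1 ≤ N → (4 * Real.sqrt 3) ^ N / 2 ^ h * (PlaneGraphs.tr S : ℝ) <
        (6.9283 : ℝ) ^ N / 2 ^ h * (PlaneGraphs.tr S : ℝ))) ∧
    ((N : ℝ) / 2 < (h : ℝ) →
      (PlaneGraphs.pg S : ℝ) ≤ 8 ^ N * (3 / 8 : ℝ) ^ h * (PlaneGraphs.tr S : ℝ)) := by
  subst hN hh
  refine ⟨fun _ => ⟨PlaneGraphs.pg_le hS fun k m H hH h1 _ h3 => ?_, fun hN => ?_⟩,
    fun _ => PlaneGraphs.pg_le hS fun k m H hH h1 h2 _ => ?_⟩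
  · exact PlaneGraphs.PointConfig.weight_le_sqrt_pow (by omega) (by omega)
  · have h3 : 4 * Real.sqrt 3 < 6.9283 := by
      have : Real.sqrt 3 < 6.9283 / 4 := by
        rw [Real.sqrt_lt' (by norm_num)]; norm_num
      linarith
    have htr : (0 : ℝ) < PlaneGraphs.tr S := by exact_mod_cast PlaneGraphs.tr_pos hS
    have := pow_lt_pow_left₀ h3 (by positivity) (by omega : S.card ≠ 0)
    gcongr
  · exact PlaneGraphs.PointConfig.weight_le_eight_pow (by omega) (by omega)
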